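/- Let $I=(0,\infty)$, $\mu\in\mathbb R$, $\nu\ge -\tfrac12$, $0<\theta<\pi$. For $t,y>0$ let $$K^{\theta}(t,y)=\frac{e^{i(1+\nu)(\theta-\pi/2)}}{(\sin\theta)^{1+\mu}}\,e^{\frac i2(t^2+y^2)\cot\theta}\,(ty\csc\theta)^{-\mu}J_\nu(ty\csc\theta)\,t^{1+2\mu},\qquad K^{-\theta}=\overline{K^{\theta}},$$ where $J_\nu$ is the Bessel function of the first kind, and let $$(\mathcal H^{-\theta}_{\nu,\mu}f)(y)=\int_0^\infty K^{-\theta}(x,y)f(x)\,dx,\qquad y>0 .$$ For $\alpha,\beta,A,B\ge 0$ and a nonempty set $S\subseteq\{+1,-1\}$ of signs let $\mathbb H^{\beta,B}_{\alpha,A}(I;S)$ be the space of infinitely differentiable $f:I\to\mathbb C$ such that for all $\delta,\sigma>0$ and $\varepsilon\in S$ $$\|f\|_{\varepsilon,\delta,\sigma}=\sup_{k,q\in\mathbb N_0,\;x>0}\frac{\left|x^k(x^{-1}D_x)^q\left[e^{\varepsilon\frac i2x^2\cot\theta}x^{\mu-\nu}f(x)\right]\right|}{(A+\delta)^k k^{k\alpha}(B+\sigma)^q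 q^{q\beta}}<\infty$$ (with $0^0=1$), with the locally convex topology generated by these norms. Let $\alpha,\beta,A,B\ge0$. Then the integral defining $\mathcal H^{-\theta}_{\nu,\mu}f(y)$ converges absolutely for every $y>0$ and every $f$ in the spaces on the left below, and: (i) $\mathcal H^{-\theta}_{\nu,\mu}$ is a continuous linear map $$\mathbb H^{\beta,B}_{\alpha,A}(I;\{-1\})\longrightarrow \mathbb H^{2\alpha,\,A^2(2e)^{2\alpha}}_{\alpha+\beta,\,ABe^{\alpha}}(I;\{+1\});$$ (ii) if $\alpha>0$, then $\mathcal H^{-\theta}_{\nu,\mu}$ is also a continuous linear map $$\mathbb H^{\beta,B}_{\alpha,A}(I;\{+1,-1\})\longrightarrow \mathbb H^{2\alpha,\,A^2(2e)^{2\alpha}}_{\alpha+\beta,\,ABe^{\alpha}}(I;\{+1,-1\}).$$ -/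

import Mathlib

noncomputable section

open scoped ContDiff

namespace FrHankel

/-- The Bessel function of the first kind `J_ν(z)`, through its power series; it is only used
for `z > 0` (and `ν ≥ -1/2`). -/
def besselJ (ν z : ℝ) : ℝ :=
  ∑' m : ℕ, (-1) ^ m / ((m.factorial : ℝ) * Real.Gamma (m + ν + 1)) * (z / 2) ^ (2 * (m : ℝ) + ν)

/-- The constant `C_{ν,μ,θ} = e^{i(1+ν)(θ-π/2)} / (sin θ)^{1+μ}`. -/
def hankelConst (ν μ θ : ℝ) : ℂ :=
  Complex.exp (Complex.I * (((1 + ν) * (θ - Real.pi / 2) : ℝ) : ℂ)) /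
    ((Real.sin θ ^ (1 + μ) : ℝ) : ℂ)

/-- The kernel `K^θ(t, y)` of the fractional Hankel transform, for `0 < θ < π` and `t, y > 0`:
`C_{ν,μ,θ} e^{(i/2)(t²+y²) cot θ} (ty csc θ)^{-μ} J_ν(ty csc θ) t^{1+2μ}`.
At `θ = π/2` it is `(ty)^{-μ} J_ν(ty) t^{1+2μ}`. -/
def kernel (ν μ θ t y : ℝ) : ℂ :=
  hankelConst ν μ θ *
    Complex.exp (Complex.I / 2 * (((t ^ 2 + y ^ 2) * Real.cot θ : ℝ) : ℂ)) *
    (((t * y * (Real.sin θ)⁻¹) ^ (-μ) * besselJ ν (t * y * (Real.sin θ)⁻¹) *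
      t ^ (1 + 2 * μ) : ℝ) : ℂ)

/-- The kernel `K^{-θ}`, the complex conjugate of `K^θ`. -/
def invKernel (ν μ θ t y : ℝ) : ℂ := (starRingEnd ℂ) (kernel ν μ θ t y)

/-- The inverse fractional Hankel transform
`(H^{-θ}_{ν,μ} f)(y) = ∫₀^∞ K^{-θ}(x, y) f(x) dx`, for `y > 0`. -/
def invHankel (ν μ θ : ℝ) (f : ℝ → ℂ) (y : ℝ) : ℂ :=
  ∫ x in Set.Ioi (0 : ℝ), invKernel ν μ θ x y * f x

/-- The operator `x⁻¹ D_x`. -/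
def xinvD (f : ℝ → ℂ) (x : ℝ) : ℂ := ((x⁻¹ : ℝ) : ℂ) * deriv f x

/-- The function `x ↦ e^{ε (i/2) x² cot θ} x^{μ-ν} f(x)`; the sign `ε` is `1` or `-1`. -/
def weighted (ν μ θ ε : ℝ) (f : ℝ → ℂ) (x : ℝ) : ℂ :=
  Complex.exp ((ε : ℂ) * (Complex.I / 2) * ((x ^ 2 * Real.cot θ : ℝ) : ℂ)) *
    ((x ^ (μ - ν) : ℝ) : ℂ) * f x

/-- The denominators `a^k k^{kα} b^q q^{qβ}` (with `0^0 = 1`). -/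
def growth (α a β b : ℝ) (k q : ℕ) : ℝ :=
  a ^ k * (k : ℝ) ^ ((k : ℝ) * α) * (b ^ q * (q : ℝ) ^ ((q : ℝ) * β))

/-- The quantity
`|x^k (x⁻¹D_x)^q [e^{ε(i/2)x² cot θ} x^{μ-ν} f(x)]| / (a^k k^{kα} b^q q^{qβ})`,
for `i = (k, q, x)` with `k, q ∈ ℕ₀` and `x ∈ (0, ∞)`. -/
def quotient (ν μ θ ε α a β b : ℝ) (f : ℝ → ℂ) (i : ℕ × ℕ × Set.Ioi (0 : ℝ)) : ℝ :=
  ‖(((i.2.2 : ℝ) ^ i.1 : ℝ) : ℂ) * xinvD^[i.2.1] (weighted ν μ θ ε f) i.2.2‖ /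
    growth α a β b i.1 i.2.1

theorem xinvD_congr {f g : ℝ → ℂ} (h : Set.EqOn f g (Set.Ioi 0)) :
    Set.EqOn (xinvD f) (xinvD g) (Set.Ioi 0) := by
  intro x hx
  have : f =ᶠ[nhds x] g := Filter.eventuallyEq_of_mem (isOpen_Ioi.mem_nhds hx) h
  simp only [xinvD, this.deriv_eq]

theorem xinvD_contDiffOn {f : ℝ → ℂ} (hf : ContDiffOn ℝ ∞ f (Set.Ioi 0)) :
    ContDiffOn ℝ ∞ (xinvD f) (Set.Ioi 0) := by
  have h1 : ContDiffOn ℝ ∞ (deriv f) (Set.Ioi 0) :=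
    ((contDiffOn_infty_iff_deriv_of_isOpen isOpen_Ioi).1 hf).2
  have h2 : ContDiffOn ℝ ∞ (fun x : ℝ => ((x⁻¹ : ℝ) : ℂ)) (Set.Ioi 0) := by
    apply Complex.ofRealCLM.contDiff.comp_contDiffOn
    exact contDiffOn_id.inv fun x hx => ne_of_gt hx
  exact h2.mul h1

theorem iterate_contDiffOn {f : ℝ → ℂ} (hf : ContDiffOn ℝ ∞ f (Set.Ioi 0)) (q : ℕ) :
    ContDiffOn ℝ ∞ (xinvD^[q] f) (Set.Ioi 0) := by
  induction q with
  | zero => exact hf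
  | succ q ih => rw [Function.iterate_succ_apply']; exact xinvD_contDiffOn ih

theorem differentiableAt_of_contDiffOn {f : ℝ → ℂ} (hf : ContDiffOn ℝ ∞ f (Set.Ioi 0)) {x : ℝ}
    (hx : x ∈ Set.Ioi (0 : ℝ)) : DifferentiableAt ℝ f x :=
  (hf.differentiableOn (by simp)).differentiableAt (isOpen_Ioi.mem_nhds hx)

theorem iterate_add {f g : ℝ → ℂ} (hf : ContDiffOn ℝ ∞ f (Set.Ioi 0))
    (hg : ContDiffOn ℝ ∞ g (Set.Ioi 0)) (q : ℕ) :
    Set.EqOn (xinvD^[q] (f + g)) (xinvD^[q] f + xinvD^[q] g) (Set.Ioi 0) := by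
  induction q with
  | zero => intro x _; rfl
  | succ q ih =>
    intro x hx
    rw [Function.iterate_succ_apply', xinvD_congr ih hx, Pi.add_apply,
      Function.iterate_succ_apply', Function.iterate_succ_apply']
    simp only [xinvD]
    rw [deriv_add (differentiableAt_of_contDiffOn (iterate_contDiffOn hf q) hx)
      (differentiableAt_of_contDiffOn (iterate_contDiffOn hg q) hx), mul_add]

theorem iterate_smul {f : ℝ → ℂ} (c : ℂ) (hf : ContDiffOn ℝ ∞ f (Set.Ioi 0)) (q : ℕ) :
    Set.EqOn (xinvD^[q] (c • f)) (c • xinvD^[q] f) (Set.Ioi 0) := by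
  induction q with
  | zero => intro x _; rfl
  | succ q ih =>
    intro x hx
    rw [Function.iterate_succ_apply', xinvD_congr ih hx, Pi.smul_apply,
      Function.iterate_succ_apply']
    simp only [xinvD]
    rw [deriv_const_smul c (differentiableAt_of_contDiffOn (iterate_contDiffOn hf q) hx),
      smul_eq_mul, smul_eq_mul, mul_left_comm]

theorem weighted_contDiffOn (ν μ θ ε : ℝ) {f : ℝ → ℂ} (hf : ContDiffOn ℝ ∞ f (Set.Ioi 0)) :
    ContDiffOn ℝ ∞ (weighted ν μ θ ε f) (Set.Ioi 0) := by
  refine ContDiffOn.mul (ContDiffOn.mul ?_ ?_) hf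
  · apply ContDiff.contDiffOn
    apply ContDiff.cexp
    apply ContDiff.mul contDiff_const
    exact Complex.ofRealCLM.contDiff.comp ((contDiff_id.pow 2).mul contDiff_const)
  · apply Complex.ofRealCLM.contDiff.comp_contDiffOn
    exact contDiffOn_id.rpow_const_of_ne fun x hx => ne_of_gt hx

theorem weighted_add (ν μ θ ε : ℝ) (f g : ℝ → ℂ) :
    weighted ν μ θ ε (f + g) = weighted ν μ θ ε f + weighted ν μ θ ε g := by
  ext x; simp only [weighted, Pi.add_apply, mul_add]

theorem weighted_smul (ν μ θ ε : ℝ) (c : ℂ) (f : ℝ → ℂ) :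
    weighted ν μ θ ε (c • f) = c • weighted ν μ θ ε f := by
  ext x; simp only [weighted, Pi.smul_apply, smul_eq_mul, mul_left_comm]

/-- `quotient` is well behaved under addition once the denominators are nonnegative. -/
theorem quotient_add_le (ν μ θ ε α : ℝ) {a : ℝ} (β : ℝ) {b : ℝ} (ha : 0 ≤ a) (hb : 0 ≤ b)
    {f g : ℝ → ℂ} (hf : ContDiffOn ℝ ∞ f (Set.Ioi 0)) (hg : ContDiffOn ℝ ∞ g (Set.Ioi 0))
    (i : ℕ × ℕ × Set.Ioi (0 : ℝ)) :
    quotient ν μ θ ε α a β b (f + g) i ≤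
      quotient ν μ θ ε α a β b f i + quotient ν μ θ ε α a β b g i := by
  unfold quotient
  rw [weighted_add, iterate_add (weighted_contDiffOn ν μ θ ε hf)
    (weighted_contDiffOn ν μ θ ε hg) i.2.1 i.2.2.2, Pi.add_apply, mul_add, ← add_div]
  have : 0 ≤ growth α a β b i.1 i.2.1 := by unfold growth; positivity
  gcongr
  exact norm_add_le _ _

theorem quotient_smul (ν μ θ ε α a β b : ℝ) (c : ℂ)
    {f : ℝ → ℂ} (hf : ContDiffOn ℝ ∞ f (Set.Ioi 0)) (i : ℕ × ℕ × Set.Ioi (0 : ℝ)) :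
    quotient ν μ θ ε α a β b (c • f) i = ‖c‖ * quotient ν μ θ ε α a β b f i := by
  unfold quotient
  rw [weighted_smul, iterate_smul c (weighted_contDiffOn ν μ θ ε hf) i.2.1 i.2.2.2,
    Pi.smul_apply, smul_eq_mul, mul_left_comm, norm_mul, mul_div_assoc]

theorem quotient_nonneg (ν μ θ ε α : ℝ) {a : ℝ} (β : ℝ) {b : ℝ} (ha : 0 ≤ a) (hb : 0 ≤ b)
    (f : ℝ → ℂ) (i : ℕ × ℕ × Set.Ioi (0 : ℝ)) : 0 ≤ quotient ν μ θ ε α a β b f i := by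
  unfold quotient growth; positivity

/-- The functions of the space of type S `H^{β,B}_{α,A}(I)`, `I = (0, ∞)`, as a complex vector
space. A function on `I` is represented by its extension by `0` to the real line. The condition
is that `f` is infinitely differentiable on `I` and that, for every `δ, σ > 0` and every sign
`ε` in `S`,
`sup_{k,q,x} |x^k (x⁻¹D_x)^q [e^{ε(i/2)x² cot θ} x^{μ-ν} f(x)]|
  / ((A+δ)^k k^{kα} (B+σ)^q q^{qβ}) < ∞`. -/
def typeSSubmodule (ν μ θ : ℝ) (S : Set ℝ) (α : ℝ) (A : NNReal) (β : ℝ) (B : NNReal) :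
    Submodule ℂ (ℝ → ℂ) where
  carrier := {f | (∀ x ≤ 0, f x = 0) ∧ ContDiffOn ℝ ∞ f (Set.Ioi 0) ∧
    ∀ ε ∈ S, ∀ δ > 0, ∀ σ > 0,
      BddAbove (Set.range (quotient ν μ θ ε α (A + δ) β (B + σ) f))}
  zero_mem' := by
    refine ⟨fun _ _ => rfl, contDiffOn_const, fun ε _ δ _ σ _ => ⟨0, ?_⟩⟩
    rintro _ ⟨i, rfl⟩
    have h := quotient_smul ν μ θ ε α (A + δ) β (B + σ) 0 (f := 0) contDiffOn_const i
    rw [zero_smul, norm_zero, zero_mul] at h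
    exact h.le
  add_mem' := by
    rintro f g ⟨hf0, hf, hfb⟩ ⟨hg0, hg, hgb⟩
    refine ⟨fun x hx => by rw [Pi.add_apply, hf0 x hx, hg0 x hx, add_zero], hf.add hg,
      fun ε hε δ hδ σ hσ => ?_⟩
    obtain ⟨C, hC⟩ := hfb ε hε δ hδ σ hσ
    obtain ⟨C', hC'⟩ := hgb ε hε δ hδ σ hσ
    refine ⟨C + C', ?_⟩
    rintro _ ⟨i, rfl⟩
    exact (quotient_add_le ν μ θ ε α β (by positivity) (by positivity) hf hg i).trans
      (add_le_add (hC ⟨i, rfl⟩) (hC' ⟨i, rfl⟩))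
  smul_mem' := by
    rintro c f ⟨hf0, hf, hfb⟩
    refine ⟨fun x hx => by rw [Pi.smul_apply, hf0 x hx, smul_zero], hf.const_smul c,
      fun ε hε δ hδ σ hσ => ?_⟩
    obtain ⟨C, hC⟩ := hfb ε hε δ hδ σ hσ
    refine ⟨‖c‖ * C, ?_⟩
    rintro _ ⟨i, rfl⟩
    rw [quotient_smul ν μ θ ε α _ β _ c hf]
    exact mul_le_mul_of_nonneg_left (hC ⟨i, rfl⟩) (norm_nonneg c)

/-- The space of type S `H^{β,B}_{α,A}(I)` with the signs `S` (a type of its own, so that it does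
not carry the topology of pointwise convergence). -/
def TypeS (ν μ θ : ℝ) (S : Set ℝ) (α : ℝ) (A : NNReal) (β : ℝ) (B : NNReal) : Type :=
  typeSSubmodule ν μ θ S α A β B

namespace TypeS

variable {ν μ θ : ℝ} {S : Set ℝ} {α : ℝ} {A : NNReal} {β : ℝ} {B : NNReal}

instance : AddCommGroup (TypeS ν μ θ S α A β B) :=
  inferInstanceAs (AddCommGroup (typeSSubmodule ν μ θ S α A β B))

instance : Module ℂ (TypeS ν μ θ S α A β B) :=
  inferInstanceAs (Module ℂ (typeSSubmodule ν μ θ S α A β B))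

instance : CoeFun (TypeS ν μ θ S α A β B) (fun _ => ℝ → ℂ) := ⟨fun f => f.1⟩

/-- The norm `‖f‖ = sup_{k,q,x} |x^k (x⁻¹D_x)^q [e^{ε(i/2)x² cot θ} x^{μ-ν} f(x)]|
/ ((A+δ)^k k^{kα} (B+σ)^q q^{qβ})`, for a sign `ε` in `S` and `δ, σ > 0`; the supremum is
finite on the space. -/
def norm (i : S × Set.Ioi (0 : ℝ) × Set.Ioi (0 : ℝ)) : Seminorm ℂ (TypeS ν μ θ S α A β B) :=
  Seminorm.of (fun f => ⨆ j, quotient ν μ θ i.1 α (A + i.2.1) β (B + i.2.2) f j)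
    (by
      intro f g
      have hδ : (0 : ℝ) < i.2.1 := i.2.1.2
      have hσ : (0 : ℝ) < i.2.2 := i.2.2.2
      have : Nonempty (ℕ × ℕ × Set.Ioi (0 : ℝ)) := ⟨(0, 0, ⟨1, Set.mem_Ioi.2 one_pos⟩)⟩
      refine ciSup_le fun j => ?_
      exact (quotient_add_le ν μ θ i.1 α β (by positivity) (by positivity)
        f.2.2.1 g.2.2.1 j).trans (add_le_add
          (le_ciSup (f.2.2.2 i.1 i.1.2 _ hδ _ hσ) j) (le_ciSup (g.2.2.2 i.1 i.1.2 _ hδ _ hσ) j)))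
    (by
      intro c f
      rw [Real.mul_iSup_of_nonneg (norm_nonneg c)]
      exact iSup_congr fun j => quotient_smul ν μ θ i.1 α _ β _ c f.2.2.1 j)

/-- The locally convex topology generated by all the norms. -/
instance : TopologicalSpace (TypeS ν μ θ S α A β B) :=
  ⨅ i : S × Set.Ioi (0 : ℝ) × Set.Ioi (0 : ℝ),
    (norm (ν := ν) (μ := μ) (θ := θ) (α := α) (A := A) (β := β) (B := B)
      i).toSeminormedAddCommGroup.toUniformSpace.toTopologicalSpace

end TypeS

end FrHankel

end

/-! Write `J_ν(z) = (z/2)^ν B_ν((z/2)²)` with `B_p` the entire function `clifford p`, and put `r =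
csc θ / 2`. With `h = e^{-(i/2)x² cot θ} x^{μ-ν} f`, the transform of `f` is a constant times
`e^{-(i/2)y² cot θ} y^{ν-μ} (T_ν h)(y)`, where `T_p h(y) = ∫ x^{2p+1} B_p((xyr)²) h(x) dx`. The
weight with sign `+1` cancels both factors in `y`, so (i) is an estimate of `T_ν` alone.

Two rules govern `T_p`. Since `B_p' = -B_{p+1}`, one has `y⁻¹D_y T_p h = -2r² T_{p+1} h`
(`cliffordTransform_hasDerivAt`); integration by parts gives `T_p h = -½ T_{p+1}(x⁻¹D_x h)`
(`cliffordTransform_parts`). Hence `y^k (y⁻¹D_y)^q T_ν h` is, up to constants, `y^k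
T_{P+k}((x⁻¹D_x)^{k+1} h)` with `P = ν+q+1`.

The decisive point is a bound uniform in `k`: `|t^k B_{P+k}(t²)| ≤ 1/Γ(P+1)` for `P ≥ 0` and `t ≥ 0`
(`abs_cliffordPow_le`), proved with a decreasing quadratic form. It absorbs `y^k` at the price of
`x^{-k}`, so only moments of order about `2q+k` of the derivative of order `k+1` remain. The factor
`(2r²)^q` is beaten by `1/Γ(P+1)`, and splitting `(2q+k)^{(2q+k)α}` yields the constants `e^α` and
`(2e)^{2α}` (`growth_double_le`). Fixed shifts of the indices cost factors `(1+η)^n`, absorbed by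
`δ` and `σ`.

For the sign `-1` in (ii) a chirp `e^{-iy² cot θ}` is left over. It replaces `y⁻¹D_y` by `y⁻¹D_y +
l` with `l` a constant, and when `α > 0` this is negligible against the growth `q^{2αq}`
(`exists_chirp_growth`). -/

open scoped ContDiff

/-! ### The Bessel–Clifford function: series, derivative, recurrence -/

namespace FrHankel

/-- The entire function `s ↦ ∑ (-s)^m / (m! Γ(m + p + 1))`, a normalization of the Bessel function
`J_p`. -/
noncomputable def clifford (p s : ℝ) : ℝ :=
  ∑' m : ℕ, (-1) ^ m / ((m.factorial : ℝ) * Real.Gamma (m + p + 1)) * s ^ m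

/-- Each step of the functional equation multiplies by `m + p + 1 ≥ 1/2`. This crude bound is enough
to dominate the series by an exponential one. -/
theorem gamma_lower_bound {p : ℝ} (hp : -(1 / 2) ≤ p) (m : ℕ) :
    Real.Gamma (p + 1) * (1 / 2) ^ m ≤ Real.Gamma (m + p + 1) := by
  induction m with
  | zero => simp
  | succ m ih =>
    have hm : (0 : ℝ) ≤ m := m.cast_nonneg
    have h : Real.Gamma (((m + 1 : ℕ) : ℝ) + p + 1) = (m + p + 1) * Real.Gamma (m + p + 1) := by
      rw [← Real.Gamma_add_one (by linarith)]; push_cast; ring_nf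
    rw [h, pow_succ]
    have h0 : 0 < Real.Gamma (m + p + 1) := Real.Gamma_pos_of_pos (by linarith)
    nlinarith

theorem clifford_coeff_bound {p : ℝ} (hp : -(1 / 2) ≤ p) (m : ℕ) :
    |(-1) ^ m / ((m.factorial : ℝ) * Real.Gamma (m + p + 1))| ≤
      (Real.Gamma (p + 1))⁻¹ * (2 ^ m / m.factorial) := by
  have h0 : 0 < Real.Gamma (p + 1) := Real.Gamma_pos_of_pos (by linarith)
  have hg := gamma_lower_bound hp m
  have hpos : 0 < Real.Gamma (p + 1) * (1 / 2) ^ m := by positivity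
  have hf : (0 : ℝ) < m.factorial := by exact_mod_cast m.factorial_pos
  rw [abs_div, abs_pow, abs_neg, abs_one, one_pow, abs_of_pos (mul_pos hf (hpos.trans_le hg))]
  calc 1 / ((m.factorial : ℝ) * Real.Gamma (m + p + 1))
      ≤ 1 / ((m.factorial : ℝ) * (Real.Gamma (p + 1) * (1 / 2) ^ m)) := by gcongr
    _ = _ := by field_simp; simp

theorem clifford_summable {p : ℝ} (hp : -(1 / 2) ≤ p) (s : ℝ) :
    Summable fun m : ℕ => (-1) ^ m / ((m.factorial : ℝ) * Real.Gamma (m + p + 1)) * s ^ m := by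
  refine Summable.of_norm_bounded
    (g := fun m : ℕ => (Real.Gamma (p + 1))⁻¹ * ((2 * |s|) ^ m / m.factorial))
    ((Real.summable_pow_div_factorial _).mul_left _) fun m => ?_
  rw [norm_mul, norm_pow, Real.norm_eq_abs, Real.norm_eq_abs]
  calc _ ≤ (Real.Gamma (p + 1))⁻¹ * (2 ^ m / m.factorial) * |s| ^ m := by
        gcongr; exact clifford_coeff_bound hp m
    _ = _ := by rw [mul_pow]; ring

theorem clifford_coeff_succ {p : ℝ} (m : ℕ) :
    (-1) ^ (m + 1) / (((m + 1).factorial : ℝ) * Real.Gamma ((m + 1 : ℕ) + p + 1)) * (m + 1 : ℕ) =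
      -((-1) ^ m / ((m.factorial : ℝ) * Real.Gamma (m + (p + 1) + 1))) := by
  have h : ((m + 1 : ℕ) : ℝ) + p + 1 = m + (p + 1) + 1 := by push_cast; ring
  have hm : ((m + 1 : ℕ) : ℝ) ≠ 0 := by positivity
  rw [h, Nat.factorial_succ, Nat.cast_mul, pow_succ]
  -- `p` is unrestricted here, so the Gamma factor may be `0` by convention at a pole; both sides
  -- are then `0`.
  rcases eq_or_ne (Real.Gamma (m + (p + 1) + 1)) 0 with h0 | h0
  · simp [h0]
  · field_simp

theorem clifford_hasDerivAt {p : ℝ} (hp : -(1 / 2) ≤ p) (s : ℝ) :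
    HasDerivAt (clifford p) (-clifford (p + 1) s) s := by
  set a : ℕ → ℝ := fun m => (-1) ^ m / ((m.factorial : ℝ) * Real.Gamma (m + p + 1)) with ha
  set R := |s| + 1 with hR
  have hR0 : 0 < R := by positivity
  have hp' : -(1 / 2) ≤ p + 1 := by linarith
  -- The series differentiated termwise is, up to sign and a shift of index, the series of `clifford
  -- (p + 1)`; its absolute convergence at `R` dominates it on the ball of radius `R`.
  have hsum : Summable fun m : ℕ => |a m| * (m * R ^ (m - 1)) := by
    rw [← summable_nat_add_iff 1]
    refine ((clifford_summable hp' R).abs).congr fun m => ?_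
    have := congrArg abs (clifford_coeff_succ (p := p) m)
    rw [abs_mul, abs_neg, Nat.abs_cast] at this
    rw [abs_mul, ← this, abs_of_pos (pow_pos hR0 m), ha]
    simp only [Nat.add_sub_cancel]
    ring
  have key := hasDerivAt_tsum_of_isPreconnected (g := fun m s => a m * s ^ m)
    (g' := fun m s => a m * (m * s ^ (m - 1))) (t := Metric.ball (0 : ℝ) R) (y₀ := 0) (y := s)
    hsum Metric.isOpen_ball (convex_ball 0 R).isPreconnected
    (fun m y _ => (hasDerivAt_pow m y).const_mul (a m))
    (fun m y hy => by
      have hy' : |y| ≤ R := by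
        rw [mem_ball_zero_iff, Real.norm_eq_abs] at hy; exact hy.le
      rw [norm_mul, norm_mul, norm_pow, Real.norm_eq_abs, Real.norm_eq_abs, Real.norm_eq_abs,
        Nat.abs_cast]
      gcongr)
    (Metric.mem_ball_self hR0) (clifford_summable hp 0)
    (by rw [mem_ball_zero_iff, Real.norm_eq_abs]; linarith)
  refine HasDerivAt.congr_deriv (f := clifford p) key ?_
  have hs : Summable fun m : ℕ => a m * (m * s ^ (m - 1)) := by
    refine Summable.of_norm_bounded hsum fun m => ?_
    rw [norm_mul, norm_mul, norm_pow, Real.norm_eq_abs, Real.norm_eq_abs, Real.norm_eq_abs,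
        Nat.abs_cast]
    gcongr
    linarith
  rw [hs.tsum_eq_zero_add, clifford, ← tsum_neg]
  simp only [Nat.cast_zero, zero_mul, mul_zero, zero_add]
  refine tsum_congr fun m => ?_
  rw [← neg_mul, ← clifford_coeff_succ, ha]
  simp only [Nat.add_sub_cancel]
  ring

theorem clifford_continuous {p : ℝ} (hp : -(1 / 2) ≤ p) : Continuous (clifford p) :=
  continuous_iff_continuousAt.2 fun s => (clifford_hasDerivAt hp s).continuousAt

theorem clifford_zero (p : ℝ) : clifford p 0 = (Real.Gamma (p + 1))⁻¹ := by
  rw [clifford, tsum_eq_single 0 fun m hm => by rw [zero_pow hm, mul_zero]]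
  simp

/-- This is `J_p + J_{p+2} = (2(p+1)/z) J_{p+1}` in the present normalization, obtained by comparing
coefficients. -/
theorem clifford_recurrence {p : ℝ} (hp : -(1 / 2) ≤ p) (s : ℝ) :
    clifford p s = (p + 1) * clifford (p + 1) s - s * clifford (p + 2) s := by
  have h0 := clifford_summable hp s
  have h1 := clifford_summable (p := p + 1) (by linarith) s
  have h2 := clifford_summable (p := p + 2) (by linarith) s
  rw [eq_sub_iff_add_eq, clifford, clifford, clifford, ← tsum_mul_left, ← tsum_mul_left,
    h0.tsum_eq_zero_add, (h1.mul_left _).tsum_eq_zero_add, add_assoc,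
    ← Summable.tsum_add ((summable_nat_add_iff 1).2 h0) (h2.mul_left _)]
  have hG : Real.Gamma (p + 1 + 1) = (p + 1) * Real.Gamma (p + 1) :=
    Real.Gamma_add_one (by linarith)
  have hG0 : 0 < Real.Gamma (p + 1) := Real.Gamma_pos_of_pos (by linarith)
  congr 1
  · simp only [pow_zero, Nat.factorial_zero, Nat.cast_zero, Nat.cast_one, zero_add, hG]
    have : p + 1 ≠ 0 := by linarith
    field_simp
  · refine tsum_congr fun m => ?_
    have hm : (0 : ℝ) ≤ m := m.cast_nonneg
    have e1 : ((m + 1 : ℕ) : ℝ) + p + 1 = m + p + 2 := by push_cast; ring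
    have e2 : ((m + 1 : ℕ) : ℝ) + (p + 1) + 1 = m + p + 2 + 1 := by push_cast; ring
    have e3 : (m : ℝ) + (p + 2) + 1 = m + p + 2 + 1 := by ring
    rw [e1, e2, e3, Real.Gamma_add_one (by linarith), Nat.factorial_succ]
    have g0 : Real.Gamma (m + p + 2) ≠ 0 := (Real.Gamma_pos_of_pos (by linarith)).ne'
    have hf : (m.factorial : ℝ) ≠ 0 := by exact_mod_cast m.factorial_ne_zero
    have h3 : (m : ℝ) + p + 2 ≠ 0 := by linarith
    have h4 : (m : ℝ) + 1 ≠ 0 := by linarith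
    push_cast
    field_simp
    ring

theorem besselJ_eq {ν z : ℝ} (hz : 0 < z) :
    besselJ ν z = (z / 2) ^ ν * clifford ν ((z / 2) ^ 2) := by
  rw [besselJ, clifford, ← tsum_mul_left]
  refine tsum_congr fun m => ?_
  rw [Real.rpow_add (by positivity), ← pow_mul, ← Real.rpow_natCast (z / 2) (2 * m)]
  push_cast
  ring

/-! ### Uniform bounds by a decreasing quadratic form -/

/-- The functions `t ↦ t^k B_{p+k}(t²)`, where `B` is `clifford`. -/
noncomputable def cliffordPow (p : ℝ) (k : ℕ) (t : ℝ) : ℝ := t ^ k * clifford (p + k) (t ^ 2)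

theorem cliffordPow_continuous {p : ℝ} (hp : -(1 / 2) ≤ p) (k : ℕ) :
    Continuous (cliffordPow p k) := by
  have : (0 : ℝ) ≤ k := k.cast_nonneg
  exact (continuous_id.pow k).mul ((clifford_continuous (by linarith)).comp (continuous_id.pow 2))

theorem cliffordPow_hasDerivAt {p : ℝ} (hp : -(1 / 2) ≤ p) (k : ℕ) {t : ℝ} (ht : 0 < t) :
    HasDerivAt (cliffordPow p k) (k / t * cliffordPow p k t - 2 * cliffordPow p (k + 1) t) t := by
  have hk : (0 : ℝ) ≤ k := k.cast_nonneg
  have h := (hasDerivAt_pow k t).mul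
    ((clifford_hasDerivAt (p := p + k) (by linarith) (t ^ 2)).comp t (hasDerivAt_pow 2 t))
  refine HasDerivAt.congr_deriv (f := cliffordPow p k) h ?_
  have e : p + ((k + 1 : ℕ) : ℝ) = p + k + 1 := by push_cast; ring
  simp only [cliffordPow, e, Function.comp]
  rcases k with _ | k
  · simp; ring
  · simp only [Nat.add_sub_cancel]
    field_simp
    push_cast
    ring

theorem cliffordPow_recurrence {p : ℝ} (hp : -(1 / 2) ≤ p) (k : ℕ) {t : ℝ} (ht : 0 < t) :
    cliffordPow p (k + 2) t = (p + k + 1) / t * cliffordPow p (k + 1) t - cliffordPow p k t := by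
  have hk : (0 : ℝ) ≤ k := k.cast_nonneg
  have h := clifford_recurrence (p := p + k) (by linarith) (t ^ 2)
  have e1 : p + ((k + 1 : ℕ) : ℝ) = p + k + 1 := by push_cast; ring
  have e2 : p + ((k + 2 : ℕ) : ℝ) = p + k + 2 := by push_cast; ring
  simp only [cliffordPow, e1, e2, h]
  field_simp
  ring

/-- The recurrence eliminates the upper neighbour `w_{k+2}` in favour of the lower one `w_k`. Having
both forms of the derivative makes the energy sum telescope. -/
theorem cliffordPow_succ_hasDerivAt {p : ℝ} (hp : -(1 / 2) ≤ p) (k : ℕ) {t : ℝ} (ht : 0 < t) :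
    HasDerivAt (cliffordPow p (k + 1))
      (2 * cliffordPow p k t - (2 * p + k + 1) / t * cliffordPow p (k + 1) t) t := by
  refine (cliffordPow_hasDerivAt hp (k + 1) ht).congr_deriv ?_
  rw [cliffordPow_recurrence hp k ht]
  push_cast
  field_simp
  ring

theorem cliffordPow_zero_zero (p : ℝ) : cliffordPow p 0 0 = (Real.Gamma (p + 1))⁻¹ := by
  simp [cliffordPow, clifford_zero]

theorem cliffordPow_succ_zero (p : ℝ) (k : ℕ) : cliffordPow p (k + 1) 0 = 0 := by
  simp [cliffordPow]

/-- The weights in the decreasing quadratic form. -/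
noncomputable def energyWeight (p : ℝ) : ℕ → ℝ
  | 0 => 1
  | k + 1 => energyWeight p k * ((2 * p + (k + 1)) / (k + 1))

theorem one_le_energyWeight {p : ℝ} (hp : 0 ≤ p) (k : ℕ) : 1 ≤ energyWeight p k := by
  induction k with
  | zero => exact le_rfl
  | succ k ih =>
    have : (1 : ℝ) ≤ (2 * p + (k + 1)) / (k + 1) := by
      rw [le_div_iff₀ (by positivity)]; linarith
    exact one_le_mul_of_one_le_of_one_le ih this

/-- The sum `w₀² + ∑_{1 ≤ k ≤ K} e_k (2p+2k)/k w_k²`, with `w_k = cliffordPow p k` and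
`e_k = energyWeight p (k-1)`. -/
noncomputable def partialEnergy (p : ℝ) : ℕ → ℝ → ℝ
  | 0, t => cliffordPow p 0 t ^ 2
  | k + 1, t => partialEnergy p k t +
      energyWeight p k * ((2 * p + 2 * (k + 1)) / (k + 1)) * cliffordPow p (k + 1) t ^ 2

theorem partialEnergy_continuous {p : ℝ} (hp : -(1 / 2) ≤ p) (k : ℕ) :
    Continuous (partialEnergy p k) := by
  induction k with
  | zero => exact (cliffordPow_continuous hp 0).pow 2
  | succ k ih => exact ih.add (continuous_const.mul ((cliffordPow_continuous hp (k + 1)).pow 2))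

theorem partialEnergy_nonneg {p : ℝ} (hp : 0 ≤ p) (k : ℕ) (t : ℝ) : 0 ≤ partialEnergy p k t := by
  induction k with
  | zero => exact sq_nonneg _
  | succ k ih =>
    have := one_le_energyWeight hp k
    have h : 0 ≤ energyWeight p k * ((2 * p + 2 * (k + 1)) / (k + 1)) *
      cliffordPow p (k + 1) t ^ 2 := by positivity
    exact add_nonneg ih h

theorem partialEnergy_zero (p : ℝ) (k : ℕ) :
    partialEnergy p k 0 = (Real.Gamma (p + 1))⁻¹ ^ 2 := by
  induction k with
  | zero => rw [partialEnergy, cliffordPow_zero_zero]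
  | succ k ih => rw [partialEnergy, ih, cliffordPow_succ_zero]; ring

/-- With `e_k = energyWeight p k`, the coefficient of `w_{k+1}²` is `e_k + e_{k+1}`. Differentiate
the `e_k` share through the lower neighbour and the `e_{k+1}` share through the upper one: the
weights satisfy `e_{k+1}(k+1) = e_k(2p+k+1)`, so the `1/t` terms cancel, and the cross terms
telescope to the last one. -/
theorem partialEnergy_hasDerivAt {p : ℝ} (hp : -(1 / 2) ≤ p) (k : ℕ) {t : ℝ} (ht : 0 < t) :
    HasDerivAt (partialEnergy p k)
      (-4 * energyWeight p k * cliffordPow p k t * cliffordPow p (k + 1) t) t := by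
  induction k with
  | zero =>
    have h := (cliffordPow_hasDerivAt hp 0 ht).pow 2
    refine HasDerivAt.congr_deriv (f := partialEnergy p 0) h ?_
    simp [energyWeight]
    ring
  | succ k ih =>
    have h := ih.add (((cliffordPow_hasDerivAt hp (k + 1) ht).pow 2).const_mul
      (energyWeight p k * ((2 * p + 2 * (k + 1)) / (k + 1))))
    refine HasDerivAt.congr_deriv (f := partialEnergy p (k + 1)) h ?_
    rw [cliffordPow_recurrence hp k ht, energyWeight]
    have : (k : ℝ) + 1 ≠ 0 := by positivity
    push_cast
    field_simp
    ring

/-- The quadratic form `∑_{k ≤ K} c_k w_k² + e w_{K+1}²` decreases. -/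
theorem energy_antitone {p : ℝ} (hp : -(1 / 2) ≤ p) (k : ℕ) (hk : 0 ≤ energyWeight p k) :
    AntitoneOn (fun t => partialEnergy p k t + energyWeight p k * cliffordPow p (k + 1) t ^ 2)
      (Set.Ici 0) := by
  have hd : ∀ t : ℝ, 0 < t → HasDerivAt
      (fun t => partialEnergy p k t + energyWeight p k * cliffordPow p (k + 1) t ^ 2)
      (-(2 * energyWeight p k * ((2 * p + k + 1) / t) * cliffordPow p (k + 1) t ^ 2)) t := by
    intro t ht
    refine ((partialEnergy_hasDerivAt hp k ht).add
      (((cliffordPow_succ_hasDerivAt hp k ht).pow 2).const_mul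
        (energyWeight p k))).congr_deriv ?_
    push_cast
    ring
  refine antitoneOn_of_deriv_nonpos (convex_Ici 0) ?_ ?_ ?_
  · exact ((partialEnergy_continuous hp k).add
      (continuous_const.mul ((cliffordPow_continuous hp (k + 1)).pow 2))).continuousOn
  · intro t ht
    rw [interior_Ici] at ht
    exact (hd t ht).differentiableAt.differentiableWithinAt
  · intro t ht
    rw [interior_Ici] at ht
    rw [(hd t ht).deriv, neg_nonpos]
    have h1 : (0 : ℝ) ≤ 2 * p + k + 1 := by have : (0 : ℝ) ≤ k := k.cast_nonneg; linarith
    have h2 : (0 : ℝ) < t := ht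
    positivity

theorem energy_le {p : ℝ} (hp : -(1 / 2) ≤ p) (k : ℕ) (hk : 0 ≤ energyWeight p k) {t : ℝ}
    (ht : 0 ≤ t) :
    partialEnergy p k t + energyWeight p k * cliffordPow p (k + 1) t ^ 2 ≤
      (Real.Gamma (p + 1))⁻¹ ^ 2 := by
  have := energy_antitone hp k hk (Set.mem_Ici.2 le_rfl) (Set.mem_Ici.2 ht) ht
  simpa only [partialEnergy_zero, cliffordPow_succ_zero, zero_pow two_ne_zero, mul_zero,
    add_zero] using this

/-- The energy inequality with `k = 0`, where the weight is `1` and the whole range `p ≥ -1/2` is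
allowed. -/
theorem abs_clifford_le {p : ℝ} (hp : -(1 / 2) ≤ p) (t : ℝ) :
    |clifford p (t ^ 2)| ≤ (Real.Gamma (p + 1))⁻¹ := by
  have hG : 0 < Real.Gamma (p + 1) := Real.Gamma_pos_of_pos (by linarith)
  have h := energy_le hp 0 (by simp [energyWeight]) (abs_nonneg t)
  refine abs_le_of_sq_le_sq ?_ (by positivity)
  simp only [partialEnergy, energyWeight, cliffordPow, sq_abs, Nat.cast_zero, add_zero, pow_zero,
    one_mul] at h
  nlinarith [sq_nonneg (|t| ^ (0 + 1) * clifford (p + ((0 + 1 : ℕ) : ℝ)) (t ^ 2))]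

/-- For `p ≥ 0` the weights are at least `1`, so the last square of the energy is at most its value
at `t = 0`. The bound does not depend on `k`. -/
theorem abs_cliffordPow_le {p : ℝ} (hp : 0 ≤ p) (k : ℕ) {t : ℝ} (ht : 0 ≤ t) :
    |cliffordPow p k t| ≤ (Real.Gamma (p + 1))⁻¹ := by
  have hG : 0 < Real.Gamma (p + 1) := Real.Gamma_pos_of_pos (by linarith)
  rcases k with _ | k
  · simpa [cliffordPow] using abs_clifford_le (p := p) (by linarith) t
  have he := one_le_energyWeight hp k
  have h := energy_le (p := p) (by linarith) k (by linarith) ht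
  have h0 := partialEnergy_nonneg hp k t
  refine abs_le_of_sq_le_sq ?_ (by positivity)
  nlinarith [sq_nonneg (cliffordPow p (k + 1) t)]

end FrHankel

/-! ### The transform with Clifford kernel: differentiation and integration by parts -/

namespace FrHankel

open MeasureTheory Set Filter Topology

theorem integrableOn_of_decay {E : Type*} [NormedAddCommGroup E] [NormedSpace ℝ E] {F : ℝ → E}
    (hF : ContinuousOn F (Ioi 0)) {M : ℝ} (hM : ∀ x, 0 < x → (1 + x ^ 2) * ‖F x‖ ≤ M) :
    IntegrableOn F (Ioi 0) ∧ ‖∫ x in Ioi 0, F x‖ ≤ Real.pi * M := by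
  have hM0 : 0 ≤ M := (by positivity : (0 : ℝ) ≤ _).trans (hM 1 one_pos)
  have hg : Integrable (fun x : ℝ => M * (1 + x ^ 2)⁻¹) := integrable_inv_one_add_sq.const_mul M
  have hle : ∀ᵐ x ∂(volume.restrict (Ioi (0 : ℝ))), ‖F x‖ ≤ M * (1 + x ^ 2)⁻¹ := by
    refine (ae_restrict_iff' measurableSet_Ioi).2 (Eventually.of_forall fun x hx => ?_)
    rw [← div_eq_mul_inv, le_div_iff₀ (by positivity), mul_comm]
    exact hM x hx
  refine ⟨hg.integrableOn.mono' (hF.aestronglyMeasurable measurableSet_Ioi) hle, ?_⟩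
  calc ‖∫ x in Ioi 0, F x‖ ≤ ∫ x in Ioi (0 : ℝ), M * (1 + x ^ 2)⁻¹ :=
        norm_integral_le_of_norm_le hg.integrableOn hle
    _ ≤ ∫ x : ℝ, M * (1 + x ^ 2)⁻¹ :=
        setIntegral_le_integral hg (Eventually.of_forall fun x => by positivity)
    _ = Real.pi * M := by rw [integral_const_mul, integral_univ_inv_one_add_sq, mul_comm]

/-- Rapid decay at infinity and boundedness near `0`. -/
def RapidDecay (h : ℝ → ℂ) : Prop :=
  ∀ k : ℕ, ∃ C, ∀ x, 0 < x → x ^ k * ‖h x‖ ≤ C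

/-- The norms only see integer powers of `x`; the real power is compared with `1` on `x ≤ 1` and
with `x ^ J` on `x ≥ 1`. -/
theorem one_add_sq_mul_rpow_le {s : ℝ} (hs : 0 ≤ s) {J : ℕ} (hJ : s + 2 ≤ J) {x : ℝ} (hx : 0 < x) :
    (1 + x ^ 2) * x ^ s ≤ 2 * (1 + x ^ J) := by
  rcases le_total x 1 with h | h
  · have h1 : x ^ s ≤ 1 := Real.rpow_le_one hx.le h hs
    have h2 : 1 + x ^ 2 ≤ 2 := by nlinarith
    have h3 : 0 ≤ x ^ s := by positivity
    have h4 : 0 ≤ x ^ J := by positivity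
    nlinarith
  · have h1 : x ^ 2 * x ^ s ≤ x ^ J := by
      rw [← Real.rpow_natCast x J, ← Real.rpow_two, ← Real.rpow_add hx]
      exact Real.rpow_le_rpow_of_exponent_le h (by linarith)
    have h2 : 1 + x ^ 2 ≤ 2 * x ^ 2 := by nlinarith
    have h3 : 0 ≤ x ^ s := by positivity
    nlinarith

theorem RapidDecay.rpow_bound {h : ℝ → ℂ} (hh : RapidDecay h) {s : ℝ} (hs : 0 ≤ s) :
    ∃ C, ∀ x, 0 < x → (1 + x ^ 2) * (x ^ s * ‖h x‖) ≤ C := by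
  obtain ⟨J, hJ⟩ := exists_nat_ge (s + 2)
  obtain ⟨C₀, h₀⟩ := hh 0
  obtain ⟨C₁, h₁⟩ := hh J
  refine ⟨2 * (C₀ + C₁), fun x hx => ?_⟩
  have := mul_le_mul_of_nonneg_right (one_add_sq_mul_rpow_le hs hJ hx) (norm_nonneg (h x))
  have h2 := h₀ x hx
  have h3 := h₁ x hx
  rw [pow_zero] at h2
  linarith

/-- The functions all of whose iterates under `x⁻¹ D_x` decay rapidly. -/
def RapidSmooth (h : ℝ → ℂ) : Prop :=
  ContDiffOn ℝ ∞ h (Ioi 0) ∧ ∀ q, RapidDecay (xinvD^[q] h)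

theorem RapidSmooth.xinvD {h : ℝ → ℂ} (hh : RapidSmooth h) : RapidSmooth (xinvD h) :=
  ⟨xinvD_contDiffOn hh.1, fun q => by rw [← Function.iterate_succ_apply]; exact hh.2 (q + 1)⟩

theorem RapidSmooth.iterate {h : ℝ → ℂ} (hh : RapidSmooth h) (n : ℕ) :
    RapidSmooth (FrHankel.xinvD^[n] h) := by
  induction n with
  | zero => exact hh
  | succ n ih => rw [Function.iterate_succ_apply']; exact ih.xinvD

/-- The kernel `x^{2p+1} B_p((xyr)²)`, where `B` is `clifford`. -/
noncomputable def cliffordKernel (p r y x : ℝ) : ℝ :=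
  x ^ (2 * p + 1) * clifford p ((x * y * r) ^ 2)

/-- The Hankel type transform with kernel `cliffordKernel`. -/
noncomputable def cliffordTransform (p r : ℝ) (h : ℝ → ℂ) (y : ℝ) : ℂ :=
  ∫ x in Ioi (0 : ℝ), cliffordKernel p r y x • h x

theorem cliffordKernel_continuousOn {p : ℝ} (hp : -(1 / 2) ≤ p) (r y : ℝ) :
    ContinuousOn (cliffordKernel p r y) (Ioi 0) := by
  refine ContinuousOn.mul (fun x hx => ?_) ?_
  · exact (Real.continuousAt_rpow_const x _ (Or.inl (ne_of_gt hx))).continuousWithinAt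
  · exact ((clifford_continuous hp).comp (by fun_prop)).continuousOn

theorem abs_cliffordKernel_le {p : ℝ} (hp : -(1 / 2) ≤ p) (r y : ℝ) {x : ℝ} (hx : 0 < x) :
    |cliffordKernel p r y x| ≤ (Real.Gamma (p + 1))⁻¹ * x ^ (2 * p + 1) := by
  rw [cliffordKernel, abs_mul, abs_of_pos (Real.rpow_pos_of_pos hx _), mul_comm]
  gcongr
  exact abs_clifford_le hp _

theorem cliffordKernel_integrableOn {p : ℝ} (hp : -(1 / 2) ≤ p) (r y : ℝ) {h : ℝ → ℂ}
    (hc : ContinuousOn h (Ioi 0)) (hh : RapidDecay h) :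
    IntegrableOn (fun x => cliffordKernel p r y x • h x) (Ioi 0) := by
  have hG : 0 < Real.Gamma (p + 1) := Real.Gamma_pos_of_pos (by linarith)
  obtain ⟨C, hC⟩ := hh.rpow_bound (s := 2 * p + 1) (by linarith)
  refine (integrableOn_of_decay ((cliffordKernel_continuousOn hp r y).smul hc)
    (M := (Real.Gamma (p + 1))⁻¹ * C) fun x hx => ?_).1
  rw [Pi.smul_apply', norm_smul, Real.norm_eq_abs]
  calc (1 + x ^ 2) * (|cliffordKernel p r y x| * ‖h x‖)
      ≤ (1 + x ^ 2) * ((Real.Gamma (p + 1))⁻¹ * x ^ (2 * p + 1) * ‖h x‖) := by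
        gcongr; exact abs_cliffordKernel_le hp r y hx
    _ = (Real.Gamma (p + 1))⁻¹ * ((1 + x ^ 2) * (x ^ (2 * p + 1) * ‖h x‖)) := by ring
    _ ≤ _ := by gcongr; exact hC x hx

theorem cliffordKernel_hasDerivAt_param {p : ℝ} (hp : -(1 / 2) ≤ p) (r y : ℝ) {x : ℝ}
    (hx : 0 < x) :
    HasDerivAt (fun y => cliffordKernel p r y x)
      (-2 * r ^ 2 * y * cliffordKernel (p + 1) r y x) y := by
  have h := ((clifford_hasDerivAt hp ((x * y * r) ^ 2)).comp y
    ((((hasDerivAt_id y).const_mul x).mul_const r).pow 2)).const_mul (x ^ (2 * p + 1))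
  refine h.congr_deriv ?_
  have e : x ^ (2 * (p + 1) + 1) = x ^ (2 * p + 1) * x ^ 2 := by
    rw [← Real.rpow_two, ← Real.rpow_add hx]; ring_nf
  simp only [cliffordKernel, e, id]
  push_cast
  ring

/-- Differentiation under the integral: on the unit ball about `y` the differentiated integrand is
dominated by a multiple of `x^{2p+3} ‖h x‖`, since `clifford (p + 1)` is bounded on squares. -/
theorem cliffordTransform_hasDerivAt {p : ℝ} (hp : -(1 / 2) ≤ p) (r : ℝ) {h : ℝ → ℂ}
    (hc : ContinuousOn h (Ioi 0)) (hh : RapidDecay h) (y : ℝ) :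
    HasDerivAt (cliffordTransform p r h)
      ((-2 * r ^ 2 * y : ℝ) • cliffordTransform (p + 1) r h y) y := by
  have hp1 : -(1 / 2) ≤ p + 1 := by linarith
  have hG : 0 < Real.Gamma (p + 1 + 1) := Real.Gamma_pos_of_pos (by linarith)
  obtain ⟨C, hC⟩ := hh.rpow_bound (s := 2 * (p + 1) + 1) (by linarith)
  set K : ℝ := 2 * r ^ 2 * (|y| + 1) * (Real.Gamma (p + 1 + 1))⁻¹ with hK
  have hbound : IntegrableOn (fun x : ℝ => K * (x ^ (2 * (p + 1) + 1) * ‖h x‖)) (Ioi 0) := by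
    refine Integrable.const_mul ?_ K
    refine (integrableOn_of_decay (M := C) ?_ fun x hx => ?_).1
    · refine ContinuousOn.mul (fun x hx => ?_) hc.norm
      exact (Real.continuousAt_rpow_const x _ (Or.inl (ne_of_gt hx))).continuousWithinAt
    · rw [Real.norm_of_nonneg (by positivity)]; exact hC x hx
  have key := hasDerivAt_integral_of_dominated_loc_of_deriv_le
    (μ := volume.restrict (Ioi (0 : ℝ)))
    (F := fun y x => cliffordKernel p r y x • h x)
    (F' := fun y x => (-2 * r ^ 2 * y * cliffordKernel (p + 1) r y x) • h x)
    (bound := fun x : ℝ => K * (x ^ (2 * (p + 1) + 1) * ‖h x‖)) (x₀ := y)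
    (Metric.ball_mem_nhds y one_pos)
    (Eventually.of_forall fun y =>
      ((cliffordKernel_continuousOn hp r y).smul hc).aestronglyMeasurable measurableSet_Ioi)
    (cliffordKernel_integrableOn hp r y hc hh)
    (((continuousOn_const.mul (cliffordKernel_continuousOn hp1 r y)).smul hc).aestronglyMeasurable
      measurableSet_Ioi)
    ((ae_restrict_iff' measurableSet_Ioi).2 (Eventually.of_forall fun x hx z hz => by
      have hz' : |z| ≤ |y| + 1 := by
        have h1 : |z - y| < 1 := hz
        have h2 := abs_sub_abs_le_abs_sub z y
        linarith
      rw [norm_smul, Real.norm_eq_abs, abs_mul, abs_mul, abs_mul, abs_neg, abs_two,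
        abs_of_nonneg (sq_nonneg r)]
      calc 2 * r ^ 2 * |z| * |cliffordKernel (p + 1) r z x| * ‖h x‖
          ≤ 2 * r ^ 2 * (|y| + 1) * ((Real.Gamma (p + 1 + 1))⁻¹ * x ^ (2 * (p + 1) + 1)) *
              ‖h x‖ := by
            gcongr; exact abs_cliffordKernel_le hp1 r z hx
        _ = _ := by rw [hK]; ring))
    hbound
    ((ae_restrict_iff' measurableSet_Ioi).2 (Eventually.of_forall fun x hx z _ =>
      (cliffordKernel_hasDerivAt_param hp r z hx).smul_const (h x)))
  refine key.2.congr_deriv ?_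
  simp only [mul_smul, cliffordTransform]
  simp only [integral_smul]

theorem cliffordTransform_contDiff_nat (n : ℕ) : ∀ {p : ℝ}, -(1 / 2) ≤ p → ∀ (r : ℝ) {h : ℝ → ℂ},
    ContinuousOn h (Ioi 0) → RapidDecay h → ContDiff ℝ n (cliffordTransform p r h) := by
  induction n with
  | zero =>
    intro p hp r h hc hh
    exact contDiff_zero.2 (continuous_iff_continuousAt.2 fun y =>
      (cliffordTransform_hasDerivAt hp r hc hh y).continuousAt)
  | succ n ih =>
    intro p hp r h hc hh
    push_cast
    refine contDiff_succ_iff_deriv.2 ⟨fun y =>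
      (cliffordTransform_hasDerivAt hp r hc hh y).differentiableAt, by simp, ?_⟩
    have : deriv (cliffordTransform p r h) =
        fun y => (-2 * r ^ 2 * y : ℝ) • cliffordTransform (p + 1) r h y :=
      funext fun y => (cliffordTransform_hasDerivAt hp r hc hh y).deriv
    rw [this]
    exact ContDiff.smul (f := fun y : ℝ => -2 * r ^ 2 * y) (contDiff_const.mul contDiff_id)
      (ih (p := p + 1) (by linarith) r hc hh)

theorem cliffordTransform_contDiff {p : ℝ} (hp : -(1 / 2) ≤ p) (r : ℝ) {h : ℝ → ℂ}
    (hh : RapidSmooth h) : ContDiff ℝ ∞ (cliffordTransform p r h) :=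
  contDiff_infty.2 fun n => cliffordTransform_contDiff_nat n hp r hh.1.continuousOn (hh.2 0)

theorem iterate_congr {f g : ℝ → ℂ} (h : EqOn f g (Ioi 0)) (q : ℕ) :
    EqOn (xinvD^[q] f) (xinvD^[q] g) (Ioi 0) := by
  induction q with
  | zero => exact h
  | succ q ih =>
    rw [Function.iterate_succ_apply', Function.iterate_succ_apply']; exact xinvD_congr ih

theorem iterate_cliffordTransform {p : ℝ} (hp : -(1 / 2) ≤ p) (r : ℝ) {h : ℝ → ℂ}
    (hh : RapidSmooth h) (q : ℕ) :
    EqOn (xinvD^[q] (cliffordTransform p r h))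
      (fun y => ((-2 * r ^ 2) ^ q : ℝ) • cliffordTransform (p + q) r h y) (Ioi 0) := by
  induction q with
  | zero => intro y _; simp
  | succ q ih =>
    intro y hy
    have hq : (0 : ℝ) ≤ q := q.cast_nonneg
    have hy0 : (y : ℂ) ≠ 0 := by exact_mod_cast ne_of_gt (mem_Ioi.1 hy)
    have hd := (cliffordTransform_hasDerivAt (p := p + q) (by linarith) r hh.1.continuousOn
      (hh.2 0) y).const_smul ((-2 * r ^ 2) ^ q : ℝ)
    rw [Function.iterate_succ_apply', xinvD_congr ih hy, xinvD, HasDerivAt.deriv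
      (f := fun y => ((-2 * r ^ 2) ^ q : ℝ) • cliffordTransform (p + q) r h y) hd]
    simp only [Complex.real_smul]
    have e : p + ((q + 1 : ℕ) : ℝ) = p + q + 1 := by push_cast; ring
    rw [e]
    push_cast
    field_simp
    ring

/-- The recurrence collapses the product rule. The result is an explicit antiderivative of the
kernel, itself `x` times a kernel of order `p + 1`. -/
theorem rpow_mul_clifford_hasDerivAt {p : ℝ} (hp : -(1 / 2) ≤ p) (a : ℝ) {x : ℝ} (hx : 0 < x) :
    HasDerivAt (fun x : ℝ => x ^ (2 * p + 2) * clifford (p + 1) ((x * a) ^ 2))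
      (2 * (x ^ (2 * p + 1) * clifford p ((x * a) ^ 2))) x := by
  have h := (Real.hasDerivAt_rpow_const (x := x) (p := 2 * p + 2) (Or.inl hx.ne')).mul
    ((clifford_hasDerivAt (p := p + 1) (by linarith) ((x * a) ^ 2)).comp x
      (((hasDerivAt_id x).mul_const a).pow 2))
  refine h.congr_deriv ?_
  have e1 : x ^ (2 * p + 2) = x ^ (2 * p + 1) * x := by
    rw [← Real.rpow_add_one hx.ne']; ring_nf
  have e2 : (2 : ℝ) * p + 2 - 1 = 2 * p + 1 := by ring
  have e3 : p + 1 + 1 = p + 2 := by ring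
  rw [clifford_recurrence hp, e2, e1, e3]
  simp only [id, Function.comp, Pi.pow_apply]
  push_cast
  ring

/-- Integrate the derivative of `W`, the antiderivative of twice the kernel times `h`. The boundary
terms vanish: at `0` because `2p + 2 > 0` and `h` is bounded, at infinity by rapid decay. -/
theorem cliffordTransform_parts {p : ℝ} (hp : -(1 / 2) ≤ p) (r : ℝ) {h : ℝ → ℂ}
    (hh : RapidSmooth h) (y : ℝ) :
    cliffordTransform p r h y =
      (-(1 / 2) : ℝ) • cliffordTransform (p + 1) r (xinvD h) y := by
  have hp1 : -(1 / 2) ≤ p + 1 := by linarith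
  have hG : 0 < Real.Gamma (p + 1 + 1) := Real.Gamma_pos_of_pos (by linarith)
  set W : ℝ → ℂ := fun x => (x ^ (2 * p + 2) * clifford (p + 1) ((x * y * r) ^ 2)) • h x with hW
  have hW0 : W 0 = 0 := by
    rw [hW]; simp only [Real.zero_rpow (by linarith : 2 * p + 2 ≠ 0), zero_mul, zero_smul]
  have hle : ∀ x, 0 < x →
      ‖W x‖ ≤ (Real.Gamma (p + 1 + 1))⁻¹ * (x ^ (2 * p + 2) * ‖h x‖) := by
    intro x hx
    rw [hW, norm_smul, Real.norm_eq_abs, abs_mul, abs_of_pos (Real.rpow_pos_of_pos hx _),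
      mul_comm (x ^ _), mul_assoc]
    gcongr
    exact abs_clifford_le hp1 _
  have hint1 := cliffordKernel_integrableOn hp r y hh.1.continuousOn (hh.2 0)
  have hint2 := cliffordKernel_integrableOn hp1 r y hh.xinvD.1.continuousOn (hh.xinvD.2 0)
  have hd : ∀ x ∈ Ioi (0 : ℝ), HasDerivAt W ((2 : ℝ) • (cliffordKernel p r y x • h x) +
      cliffordKernel (p + 1) r y x • xinvD h x) x := by
    intro x hx
    have hx' : (0 : ℝ) < x := hx
    have h1 := rpow_mul_clifford_hasDerivAt hp (y * r) hx'
    simp only [← mul_assoc] at h1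
    refine (h1.smul (differentiableAt_of_contDiffOn hh.1 hx).hasDerivAt).congr_deriv ?_
    have e : x ^ (2 * (p + 1) + 1) = x ^ (2 * p + 2) * x := by
      rw [← Real.rpow_add_one hx'.ne']; ring_nf
    have hx0 : (x : ℂ) ≠ 0 := by exact_mod_cast hx'.ne'
    simp only [cliffordKernel, xinvD, e, Complex.real_smul]
    push_cast
    field_simp
    ring
  have hcont : ContinuousWithinAt W (Ici 0) 0 := by
    obtain ⟨C, hC⟩ := hh.2 0 0
    rw [ContinuousWithinAt, hW0]
    refine squeeze_zero_norm' (a := fun x : ℝ => (Real.Gamma (p + 1 + 1))⁻¹ *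
      (x ^ (2 * p + 2) * C)) ?_ ?_
    · filter_upwards [self_mem_nhdsWithin] with x hx
      rcases (mem_Ici.1 hx).eq_or_lt with h0 | h0
      · rw [← h0, hW0, norm_zero, Real.zero_rpow (by linarith)]; simp
      · refine (hle x h0).trans ?_
        have := hC x h0
        rw [pow_zero, one_mul] at this
        gcongr
        exact this
    · have h1 : Tendsto (fun x : ℝ => x ^ (2 * p + 2)) (𝓝[Ici 0] 0) (𝓝 0) := by
        have := (Real.continuousAt_rpow_const 0 (2 * p + 2) (Or.inr (by linarith))).tendsto
        rw [Real.zero_rpow (by linarith)] at this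
        exact this.mono_left nhdsWithin_le_nhds
      simpa using (h1.mul_const C).const_mul (Real.Gamma (p + 1 + 1))⁻¹
  have hlim : Tendsto W atTop (𝓝 0) := by
    obtain ⟨C, hC⟩ := (hh.2 0).rpow_bound (s := 2 * p + 2) (by linarith)
    refine squeeze_zero_norm' (a := fun x : ℝ => (Real.Gamma (p + 1 + 1))⁻¹ * C * x⁻¹) ?_ ?_
    · filter_upwards [eventually_gt_atTop 0] with x hx
      refine (hle x hx).trans ?_
      rw [mul_assoc]
      refine mul_le_mul_of_nonneg_left ?_ (by positivity)
      rw [← div_eq_mul_inv, le_div_iff₀ hx, mul_comm]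
      refine le_trans ?_ (hC x hx)
      gcongr
      · nlinarith [sq_nonneg (x - 1)]
      · exact le_rfl
    · simpa using tendsto_inv_atTop_zero.const_mul ((Real.Gamma (p + 1 + 1))⁻¹ * C)
  have hI := integral_Ioi_of_hasDerivAt_of_tendsto hcont hd ((hint1.smul (2 : ℝ)).add hint2) hlim
  rw [hW0, sub_zero, integral_add (f := fun x => (2 : ℝ) • cliffordKernel p r y x • h x)
    (hint1.smul (2 : ℝ)) hint2, integral_smul] at hI
  simp only [cliffordTransform, Complex.real_smul] at hI ⊢
  push_cast at hI ⊢
  linear_combination (1 / 2) * hI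

theorem cliffordTransform_parts_iterate {p : ℝ} (hp : -(1 / 2) ≤ p) (r : ℝ) {h : ℝ → ℂ}
    (hh : RapidSmooth h) (y : ℝ) (n : ℕ) :
    cliffordTransform p r h y =
      ((-(1 / 2)) ^ n : ℝ) • cliffordTransform (p + n) r (xinvD^[n] h) y := by
  induction n with
  | zero => simp
  | succ n ih =>
    have hn : (0 : ℝ) ≤ n := n.cast_nonneg
    rw [ih, cliffordTransform_parts (p := p + n) (by linarith) r (hh.iterate n) y, smul_smul,
      Function.iterate_succ_apply', pow_succ]
    congr 2
    push_cast
    ring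

end FrHankel

/-! ### Arithmetic of the growth denominators -/

namespace FrHankel

open Set Filter Topology

/-- This is `(1 + n/m)^m ≤ e^n`, the source of every factor `e` in the final constants. -/
theorem add_pow_le_exp_mul (m n : ℕ) :
    ((m + n : ℕ) : ℝ) ^ m ≤ Real.exp n * (m : ℝ) ^ m := by
  rcases m.eq_zero_or_pos with rfl | hm
  · simp
  have hm' : (0 : ℝ) < m := by exact_mod_cast hm
  have h1 : ((m + n : ℕ) : ℝ) = (1 + n / m) * m := by push_cast; field_simp
  have h2 : (1 + n / m : ℝ) ≤ Real.exp (n / m) := by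
    rw [add_comm]; exact Real.add_one_le_exp _
  rw [h1, mul_pow]
  gcongr
  calc (1 + n / m : ℝ) ^ m ≤ Real.exp (n / m) ^ m := by gcongr
    _ = Real.exp n := by rw [← Real.exp_nat_mul]; congr 1; field_simp

theorem natCast_rpow_mul (n : ℕ) (α : ℝ) :
    (n : ℝ) ^ ((n : ℝ) * α) = ((n : ℝ) ^ n) ^ α := by
  rw [Real.rpow_mul n.cast_nonneg, Real.rpow_natCast]

theorem exists_pow_le_const_mul_pow (J k : ℕ) {r : ℝ} (hr : 1 < r) :
    ∃ C, 0 ≤ C ∧ ∀ n : ℕ, ((n + J : ℕ) : ℝ) ^ k ≤ C * r ^ n := by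
  obtain ⟨C, hC⟩ := (tendsto_pow_const_div_const_pow_of_one_lt k hr).bddAbove_range
  have hr0 : 0 < r := by linarith
  have hle : ∀ n : ℕ, (n : ℝ) ^ k ≤ C * r ^ n := fun n => by
    rw [← div_le_iff₀ (by positivity)]; exact hC ⟨n, rfl⟩
  have hC0 : 0 ≤ C := by
    have h := hle 0
    rw [pow_zero, mul_one] at h
    exact le_trans (by positivity) h
  refine ⟨C * r ^ J, by positivity, fun n => ?_⟩
  have := hle (n + J)
  rwa [pow_add, mul_comm (r ^ n), ← mul_assoc] at this

/-- A fixed shift costs only a power of `n + J`, which `(1 + η)^n` absorbs. The exponent `α` is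
rounded up to an integer `m`, which is harmless because the base is at least `1`. -/
theorem exists_shift_rpow_le (J : ℕ) {α η : ℝ} (hα : 0 ≤ α) (hη : 0 < η) :
    ∃ C, 0 ≤ C ∧ ∀ n : ℕ, ((n + J : ℕ) : ℝ) ^ (((n + J : ℕ) : ℝ) * α) ≤
      C * (1 + η) ^ n * (n : ℝ) ^ ((n : ℝ) * α) := by
  obtain ⟨m, hm⟩ := exists_nat_ge α
  obtain ⟨C, hC0, hC⟩ := exists_pow_le_const_mul_pow J (J * m) (r := 1 + η) (by linarith)
  refine ⟨Real.exp (J * m) * C, by positivity, fun n => ?_⟩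
  rw [natCast_rpow_mul, natCast_rpow_mul]
  have h1 : ((n + J : ℕ) : ℝ) ^ (n + J) ≤
      (Real.exp J * ((n + J : ℕ) : ℝ) ^ J) * (n : ℝ) ^ n := by
    rw [pow_add]
    have := mul_le_mul_of_nonneg_right (add_pow_le_exp_mul n J)
      (by positivity : (0 : ℝ) ≤ ((n + J : ℕ) : ℝ) ^ J)
    linarith
  have h2 : (1 : ℝ) ≤ Real.exp J * ((n + J : ℕ) : ℝ) ^ J := by
    refine one_le_mul_of_one_le_of_one_le (Real.one_le_exp (by positivity)) ?_
    rcases J.eq_zero_or_pos with rfl | hJ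
    · simp
    · exact one_le_pow₀ (by exact_mod_cast (by omega : 1 ≤ n + J))
  calc (((n + J : ℕ) : ℝ) ^ (n + J)) ^ α
      ≤ ((Real.exp J * ((n + J : ℕ) : ℝ) ^ J) * (n : ℝ) ^ n) ^ α := by gcongr
    _ = (Real.exp J * ((n + J : ℕ) : ℝ) ^ J) ^ α * ((n : ℝ) ^ n) ^ α :=
        Real.mul_rpow (by positivity) (by positivity)
    _ ≤ (Real.exp J * ((n + J : ℕ) : ℝ) ^ J) ^ (m : ℝ) * ((n : ℝ) ^ n) ^ α := by gcongr
    _ = Real.exp (J * m) * ((n + J : ℕ) : ℝ) ^ (J * m) * ((n : ℝ) ^ n) ^ α := by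
        rw [Real.rpow_natCast, mul_pow, ← pow_mul, ← Real.exp_nat_mul, mul_comm (m : ℝ)]
    _ ≤ Real.exp (J * m) * (C * (1 + η) ^ n) * ((n : ℝ) ^ n) ^ α := by gcongr; exact hC n
    _ = _ := by ring

theorem growth_nonneg (α : ℝ) {a : ℝ} (β : ℝ) {b : ℝ} (ha : 0 ≤ a) (hb : 0 ≤ b) (k q : ℕ) :
    0 ≤ growth α a β b k q := by
  unfold growth; positivity

theorem growth_pos (α : ℝ) {a : ℝ} (β : ℝ) {b : ℝ} (ha : 0 < a) (hb : 0 < b) (k q : ℕ) :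
    0 < growth α a β b k q := by
  have h : ∀ (n : ℕ) (γ : ℝ), 0 < (n : ℝ) ^ ((n : ℝ) * γ) := by
    intro n γ
    rcases n.eq_zero_or_pos with rfl | hn
    · simp
    · have : (0 : ℝ) < n := by exact_mod_cast hn
      positivity
  have h1 := h k α
  have h2 := h q β
  unfold growth; positivity

theorem growth_mono (α β : ℝ) {a a' b b' : ℝ} (ha : 0 ≤ a) (hb : 0 ≤ b) (haa : a ≤ a')
    (hbb : b ≤ b') (k q : ℕ) : growth α a β b k q ≤ growth α a' β b' k q := by
  have : 0 ≤ a' := ha.trans haa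
  unfold growth; gcongr

theorem exists_growth_shift_le (J : ℕ) {α β a b η : ℝ} (hα : 0 ≤ α) (hβ : 0 ≤ β) (ha : 0 ≤ a)
    (hb : 0 ≤ b) (hη : 0 < η) :
    ∃ C, 0 ≤ C ∧ ∀ n k : ℕ, growth α a β b (n + J) (k + 1) ≤
      C * ((1 + η) ^ n * (1 + η) ^ k * growth α a β b n k) := by
  obtain ⟨C₁, h₁, hC₁⟩ := exists_shift_rpow_le J hα hη
  obtain ⟨C₂, h₂, hC₂⟩ := exists_shift_rpow_le 1 hβ hη
  refine ⟨C₁ * a ^ J * (C₂ * b), by positivity, fun n k => ?_⟩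
  calc growth α a β b (n + J) (k + 1)
      ≤ a ^ (n + J) * (C₁ * (1 + η) ^ n * (n : ℝ) ^ ((n : ℝ) * α)) *
        (b ^ (k + 1) * (C₂ * (1 + η) ^ k * (k : ℝ) ^ ((k : ℝ) * β))) := by
        unfold growth
        gcongr
        · exact hC₁ n
        · exact hC₂ k
    _ = _ := by unfold growth; ring

/-- Split `(2q+k)^{2q+k} = (2q+k)^{2q} (2q+k)^k ≤ e^k (2q)^{2q} · e^{2q} k^k` and raise to the power
`α`. Then `k^{kα}` joins `k^{kβ}`, the factor `e^{kα}` enters the constant for `k`, and `(2e)^{2αq}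
q^{2αq}` the one for `q`. -/
theorem growth_double_le {α β a b : ℝ} (hα : 0 ≤ α) (hβ : 0 ≤ β) (ha : 0 ≤ a) (hb : 0 ≤ b)
    (k q : ℕ) :
    growth α a β b (2 * q + k) k ≤
      growth (α + β) (a * b * Real.exp α) (2 * α) (a ^ 2 * (2 * Real.exp 1) ^ (2 * α)) k q := by
  have h1 : ((2 * q + k : ℕ) : ℝ) ^ (2 * q + k) ≤
      (Real.exp k * ((2 * q : ℕ) : ℝ) ^ (2 * q)) * (Real.exp (2 * q : ℕ) * (k : ℝ) ^ k) := by
    rw [pow_add]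
    have := add_pow_le_exp_mul k (2 * q)
    rw [add_comm k] at this
    exact mul_le_mul (add_pow_le_exp_mul (2 * q) k) this (by positivity) (by positivity)
  have h2 : ((2 * q + k : ℕ) : ℝ) ^ (((2 * q + k : ℕ) : ℝ) * α) ≤
      Real.exp α ^ k * ((2 * Real.exp 1) ^ (2 * α)) ^ q * (q : ℝ) ^ ((q : ℝ) * (2 * α)) *
        (k : ℝ) ^ ((k : ℝ) * α) := by
    rw [natCast_rpow_mul (2 * q + k), natCast_rpow_mul k]
    refine (Real.rpow_le_rpow (by positivity) h1 hα).trans_eq ?_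
    rw [Real.mul_rpow (by positivity) (by positivity), Real.mul_rpow (by positivity)
      (by positivity), Real.mul_rpow (by positivity) (by positivity)]
    have e1 : Real.exp (k : ℝ) ^ α = Real.exp α ^ k := by
      rw [← Real.exp_mul, ← Real.exp_nat_mul]
    have e2 : (((2 * q : ℕ) : ℝ) ^ (2 * q)) ^ α * Real.exp ((2 * q : ℕ) : ℝ) ^ α =
        ((2 * Real.exp 1) ^ (2 * α)) ^ q * (q : ℝ) ^ ((q : ℝ) * (2 * α)) := by
      rw [← natCast_rpow_mul]
      push_cast
      rw [Real.mul_rpow (by positivity) (by positivity), Real.mul_rpow (by positivity)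
        (by positivity), mul_pow, ← Real.rpow_natCast, ← Real.rpow_natCast, ← Real.exp_mul,
        ← Real.rpow_mul zero_le_two, ← Real.exp_mul, ← Real.exp_mul]
      have e3 : (q : ℝ) * (2 * α) = 2 * q * α := by ring
      have e4 : 2 * α * (q : ℝ) = 2 * q * α := by ring
      have e5 : 1 * (2 * α) * (q : ℝ) = 2 * q * α := by ring
      rw [e3, e4, e5]
      ring
    rw [e1]
    linear_combination Real.exp α ^ k * ((k : ℝ) ^ k) ^ α * e2
  have h3 : (k : ℝ) ^ ((k : ℝ) * (α + β)) = (k : ℝ) ^ ((k : ℝ) * α) * (k : ℝ) ^ ((k : ℝ) * β) := by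
    rw [mul_add, Real.rpow_add_of_nonneg (by positivity) (by positivity) (by positivity)]
  calc growth α a β b (2 * q + k) k
      ≤ a ^ (2 * q + k) * (Real.exp α ^ k * ((2 * Real.exp 1) ^ (2 * α)) ^ q *
        (q : ℝ) ^ ((q : ℝ) * (2 * α)) * (k : ℝ) ^ ((k : ℝ) * α)) *
        (b ^ k * (k : ℝ) ^ ((k : ℝ) * β)) := by
        unfold growth; gcongr
    _ = _ := by unfold growth; rw [h3]; ring

theorem growth_mul_pow (α a β b r : ℝ) (k q : ℕ) :
    r ^ k * r ^ q * growth α a β b k q = growth α (r * a) β (r * b) k q := by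
  unfold growth; rw [mul_pow, mul_pow]; ring

/-- The growth of the transform is controlled by the growth of the function. -/
theorem exists_growth_le (J : ℕ) {α β A B : ℝ} (hα : 0 ≤ α) (hβ : 0 ≤ β) (hA : 0 ≤ A)
    (hB : 0 ≤ B) {δ σ : ℝ} (hδ : 0 < δ) (hσ : 0 < σ) :
    ∃ t, 0 < t ∧ ∃ C, 0 ≤ C ∧ ∀ k q : ℕ,
      growth α (A + t) β (B + t) (2 * q + k) (k + 1) +
        growth α (A + t) β (B + t) (2 * q + k + J) (k + 1) ≤
      C * growth (α + β) (A * B * Real.exp α + δ) (2 * α)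
        (A ^ 2 * (2 * Real.exp 1) ^ (2 * α) + σ) k q := by
  -- The index shifts cost `(1+t)^{2q+k} (1+t)^k = ((1+t)²)^{k+q}`. At `t = 0` both perturbed
  -- constants take their limiting values, so a small `t > 0` keeps them below the targets enlarged
  -- by `δ` and `σ`.
  have c1 : ContinuousAt (fun t : ℝ => (1 + t) ^ 2 * ((A + t) * (B + t) * Real.exp α)) 0 := by
    fun_prop
  have c2 : ContinuousAt
      (fun t : ℝ => (1 + t) ^ 2 * ((A + t) ^ 2 * (2 * Real.exp 1) ^ (2 * α))) 0 := by
    fun_prop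
  have l1 := c1.eventually_lt (continuousAt_const (y := A * B * Real.exp α + δ))
    (by simpa using hδ)
  have l2 := c2.eventually_lt
    (continuousAt_const (y := A ^ 2 * (2 * Real.exp 1) ^ (2 * α) + σ)) (by simpa using hσ)
  have l3 : ∀ᶠ t : ℝ in 𝓝[>] 0, 0 < t := self_mem_nhdsWithin
  obtain ⟨t, ht1, ht2, ht⟩ :=
    ((l1.filter_mono nhdsWithin_le_nhds).and ((l2.filter_mono nhdsWithin_le_nhds).and l3)).exists
  have hAt : 0 ≤ A + t := by positivity
  have hBt : 0 ≤ B + t := by positivity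
  obtain ⟨C₀, h₀, hC₀⟩ := exists_growth_shift_le 0 hα hβ hAt hBt ht
  obtain ⟨C₁, h₁, hC₁⟩ := exists_growth_shift_le J hα hβ hAt hBt ht
  refine ⟨t, ht, C₀ + C₁, by positivity, fun k q => ?_⟩
  have key : (1 + t) ^ (2 * q + k) * (1 + t) ^ k * growth α (A + t) β (B + t) (2 * q + k) k ≤
      growth (α + β) (A * B * Real.exp α + δ) (2 * α)
        (A ^ 2 * (2 * Real.exp 1) ^ (2 * α) + σ) k q := by
    calc _ = ((1 + t) ^ 2) ^ k * ((1 + t) ^ 2) ^ q *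
          growth α (A + t) β (B + t) (2 * q + k) k := by
          rw [← pow_mul, ← pow_mul]; ring
      _ ≤ ((1 + t) ^ 2) ^ k * ((1 + t) ^ 2) ^ q * growth (α + β) ((A + t) * (B + t) * Real.exp α)
          (2 * α) ((A + t) ^ 2 * (2 * Real.exp 1) ^ (2 * α)) k q := by
          gcongr; exact growth_double_le hα hβ hAt hBt k q
      _ = _ := growth_mul_pow ..
      _ ≤ _ := growth_mono _ _ (by positivity) (by positivity) ht1.le ht2.le k q
  calc _ ≤ C₀ * _ + C₁ * _ := add_le_add (hC₀ (2 * q + k) k) (hC₁ (2 * q + k) k)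
    _ ≤ C₀ * growth (α + β) (A * B * Real.exp α + δ) (2 * α)
        (A ^ 2 * (2 * Real.exp 1) ^ (2 * α) + σ) k q + C₁ * growth (α + β)
        (A * B * Real.exp α + δ) (2 * α) (A ^ 2 * (2 * Real.exp 1) ^ (2 * α) + σ) k q := by gcongr
    _ = _ := by ring

theorem rapidSmooth_of_growth {h : ℝ → ℂ} {α a β b M : ℝ} (hh : ContDiffOn ℝ ∞ h (Ioi 0))
    (hM : ∀ (k q : ℕ) (x : ℝ), 0 < x → x ^ k * ‖xinvD^[q] h x‖ ≤ M * growth α a β b k q) :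
    RapidSmooth h :=
  ⟨hh, fun q k => ⟨_, hM k q⟩⟩

/-! ### The basic estimate for the transform -/

/-- Gamma grows like a factorial, so the powers `(2r²)^q` produced by differentiation affect only
the multiplicative constant. This is why the limiting growth constants do not depend on `θ`. -/
theorem exists_pow_div_gamma_le {ν : ℝ} (hν : -(1 / 2) ≤ ν) {s : ℝ} (hs : 0 ≤ s) :
    ∃ D, 0 ≤ D ∧ ∀ q : ℕ, s ^ q * (Real.Gamma (ν + q + 1 + 1))⁻¹ ≤ D := by
  have hG : 0 < Real.Gamma (ν + 1 + 1) := Real.Gamma_pos_of_pos (by linarith)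
  have hle : ∀ q : ℕ, Real.Gamma (ν + 1 + 1) * q.factorial ≤ Real.Gamma (ν + q + 1 + 1) := by
    intro q
    induction q with
    | zero => simp
    | succ q ih =>
      have hq : (0 : ℝ) ≤ q := q.cast_nonneg
      have e : ν + ((q + 1 : ℕ) : ℝ) + 1 + 1 = (ν + q + 1 + 1) + 1 := by push_cast; ring
      rw [e, Real.Gamma_add_one (s := ν + q + 1 + 1) (by linarith), Nat.factorial_succ]
      push_cast
      have h0 : 0 < Real.Gamma (ν + 1 + 1) * q.factorial := by positivity
      nlinarith
  refine ⟨Real.exp s * (Real.Gamma (ν + 1 + 1))⁻¹, by positivity, fun q => ?_⟩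
  calc s ^ q * (Real.Gamma (ν + q + 1 + 1))⁻¹
      ≤ s ^ q * (Real.Gamma (ν + 1 + 1) * q.factorial)⁻¹ := by
        gcongr; exact hle q
    _ = s ^ q / q.factorial * (Real.Gamma (ν + 1 + 1))⁻¹ := by rw [mul_inv]; ring
    _ ≤ _ := by gcongr; exact Real.pow_div_factorial_le_exp s hs q

/-- Apply `q` differentiations and `k + 1` integrations by parts. The one beyond `k` makes `P = ν +
q + 1` nonnegative even for `ν = -1/2`, as the uniform bound requires. The integer `J ≥ (2ν + 3) +
2` pays for `x^{2ν+3}` and for integrability at infinity. -/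
theorem pow_mul_norm_cliffordTransform_le {ν : ℝ} (hν : -(1 / 2) ≤ ν) {J : ℕ}
    (hJ : 2 * ν + 5 ≤ J) {r : ℝ} (hr : 1 / 2 ≤ r) {h : ℝ → ℂ} (hh : RapidSmooth h) (k q : ℕ)
    {U : ℝ} (hU : ∀ x, 0 < x → (x ^ (2 * q + k) + x ^ (2 * q + k + J)) *
      ‖xinvD^[k + 1] h x‖ ≤ U) {y : ℝ} (hy : 0 < y) :
    y ^ k * ‖xinvD^[q] (cliffordTransform ν r h) y‖ ≤
      2 * Real.pi * ((2 * r ^ 2) ^ q * (Real.Gamma (ν + q + 1 + 1))⁻¹) * U := by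
  have hq : (0 : ℝ) ≤ q := q.cast_nonneg
  have hk : (0 : ℝ) ≤ k := k.cast_nonneg
  have hG : 0 < Real.Gamma (ν + q + 1 + 1) := Real.Gamma_pos_of_pos (by linarith)
  set h₁ := xinvD^[k + 1] h with hh₁
  have hs : RapidSmooth h₁ := hh.iterate (k + 1)
  set P := ν + q + 1 with hP
  have e1 : ν + q + ((k + 1 : ℕ) : ℝ) = P + k := by rw [hP]; push_cast; ring
  rw [iterate_cliffordTransform hν r hh q hy, norm_smul,
    cliffordTransform_parts_iterate (p := ν + q) (by linarith) r hh y (k + 1), norm_smul, e1, ← hh₁]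
  -- The exponent `2(P+k)+1` equals `(2ν+3) + (2q+k) + k`; the last `x^k` combines with `(yr)^k`
  -- into `t^k` for `t = xyr`.
  have hker : ∀ x, 0 < x → (y * r) ^ k * |cliffordKernel (P + k) r y x| ≤
      (Real.Gamma (P + 1))⁻¹ * (x ^ (2 * ν + 3) * x ^ (2 * q + k)) := by
    intro x hx
    have hw := abs_cliffordPow_le (p := P) (by linarith) k (t := x * y * r) (by positivity)
    rw [cliffordPow, abs_mul, abs_of_nonneg (by positivity)] at hw
    have e2 : x ^ (2 * (P + k) + 1) = x ^ (2 * ν + 3) * x ^ (2 * q + k) * x ^ k := by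
      rw [← Real.rpow_natCast, ← Real.rpow_natCast, ← Real.rpow_add hx, ← Real.rpow_add hx, hP]
      congr 1
      push_cast
      ring
    rw [cliffordKernel, abs_mul, abs_of_pos (Real.rpow_pos_of_pos hx _), e2]
    calc _ = ((x * y * r) ^ k * |clifford (P + k) ((x * y * r) ^ 2)|) *
          (x ^ (2 * ν + 3) * x ^ (2 * q + k)) := by ring
      _ ≤ _ := by gcongr
  have hint := (integrableOn_of_decay (M := (Real.Gamma (P + 1))⁻¹ * (2 * U))
    (F := fun x => (y * r) ^ k • cliffordKernel (P + k) r y x • h₁ x)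
    (((cliffordKernel_continuousOn (p := P + k) (by linarith) r y).smul
      hs.1.continuousOn).const_smul ((y * r) ^ k)) (fun x hx => by
      rw [norm_smul, norm_smul, Real.norm_eq_abs, Real.norm_eq_abs,
        abs_of_nonneg (by positivity : 0 ≤ (y * r) ^ k), ← mul_assoc ((y * r) ^ k)]
      have h2 := one_add_sq_mul_rpow_le (s := 2 * ν + 3) (by linarith) (J := J) (by linarith) hx
      calc _ ≤ (1 + x ^ 2) * ((Real.Gamma (P + 1))⁻¹ *
            (x ^ (2 * ν + 3) * x ^ (2 * q + k)) * ‖h₁ x‖) :=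
            mul_le_mul_of_nonneg_left
              (mul_le_mul_of_nonneg_right (hker x hx) (norm_nonneg _)) (by positivity)
        _ = (Real.Gamma (P + 1))⁻¹ * (((1 + x ^ 2) * x ^ (2 * ν + 3)) *
            (x ^ (2 * q + k) * ‖h₁ x‖)) := by ring
        _ ≤ (Real.Gamma (P + 1))⁻¹ * ((2 * (1 + x ^ J)) * (x ^ (2 * q + k) * ‖h₁ x‖)) := by
            gcongr
        _ = (Real.Gamma (P + 1))⁻¹ * (2 * ((x ^ (2 * q + k) + x ^ (2 * q + k + J)) *
            ‖h₁ x‖)) := by ring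
        _ ≤ _ := by gcongr; exact hU x hx)).2
  rw [MeasureTheory.integral_smul, norm_smul, Real.norm_of_nonneg (by positivity)] at hint
  change (y * r) ^ k * ‖cliffordTransform (P + k) r h₁ y‖ ≤ _ at hint
  have hr0 : 0 < r := by linarith
  have n1 : ‖(-2 * r ^ 2) ^ q‖ = (2 * r ^ 2) ^ q := by
    rw [norm_pow, neg_mul, norm_neg, Real.norm_of_nonneg (by positivity)]
  -- As `r ≥ 1/2`, the factor `2^{-(k+1)}` from the integrations by parts is at most `r^k`, which
  -- the kernel bound needs.
  have n2 : ‖((-(1 / 2) : ℝ)) ^ (k + 1)‖ ≤ r ^ k := by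
    rw [norm_pow, norm_neg, Real.norm_of_nonneg (by norm_num), pow_succ]
    have : ((1 : ℝ) / 2) ^ k ≤ r ^ k := by gcongr
    have : (0 : ℝ) ≤ (1 / 2) ^ k := by positivity
    linarith
  rw [n1]
  calc _ ≤ y ^ k * ((2 * r ^ 2) ^ q * (r ^ k * ‖cliffordTransform (P + k) r h₁ y‖)) := by gcongr
    _ = (2 * r ^ 2) ^ q * ((y * r) ^ k * ‖cliffordTransform (P + k) r h₁ y‖) := by ring
    _ ≤ (2 * r ^ 2) ^ q * (Real.pi * ((Real.Gamma (P + 1))⁻¹ * (2 * U))) := by gcongr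
    _ = _ := by ring

/-- The basic estimate for the transform in terms of the growth of the function. -/
theorem exists_cliffordTransform_growth {ν : ℝ} (hν : -(1 / 2) ≤ ν) {r : ℝ} (hr : 1 / 2 ≤ r)
    {α β A B : ℝ} (hα : 0 ≤ α) (hβ : 0 ≤ β) (hA : 0 ≤ A) (hB : 0 ≤ B) {δ σ : ℝ} (hδ : 0 < δ)
    (hσ : 0 < σ) :
    ∃ t, 0 < t ∧ ∃ C, 0 ≤ C ∧ ∀ (h : ℝ → ℂ) (M : ℝ), ContDiffOn ℝ ∞ h (Ioi 0) →
      (∀ (k q : ℕ) (x : ℝ), 0 < x → x ^ k * ‖xinvD^[q] h x‖ ≤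
        M * growth α (A + t) β (B + t) k q) →
      ∀ (k q : ℕ) (y : ℝ), 0 < y → y ^ k * ‖xinvD^[q] (cliffordTransform ν r h) y‖ ≤
        C * M * growth (α + β) (A * B * Real.exp α + δ) (2 * α)
          (A ^ 2 * (2 * Real.exp 1) ^ (2 * α) + σ) k q := by
  obtain ⟨J, hJ⟩ := exists_nat_ge (2 * ν + 5)
  obtain ⟨t, ht, C, hC0, hC⟩ := exists_growth_le J hα hβ hA hB hδ hσ
  obtain ⟨D, hD0, hD⟩ := exists_pow_div_gamma_le hν (s := 2 * r ^ 2) (by positivity)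
  refine ⟨t, ht, 2 * Real.pi * D * C, by positivity, fun h M hh hM k q y hy => ?_⟩
  have hM0 : 0 ≤ M := by
    have h1 := hM 0 0 1 one_pos
    have h2 : growth α (A + t) β (B + t) 0 0 = 1 := by simp [growth]
    rw [h2, mul_one] at h1
    exact le_trans (by positivity) h1
  set g := growth (α + β) (A * B * Real.exp α + δ) (2 * α)
    (A ^ 2 * (2 * Real.exp 1) ^ (2 * α) + σ) k q with hg
  have hg0 : 0 ≤ g := growth_nonneg _ _ (by positivity) (by positivity) k q
  have := pow_mul_norm_cliffordTransform_le hν hJ hr (rapidSmooth_of_growth hh hM) k q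
    (U := M * (C * g)) (fun x hx => by
      rw [add_mul]
      calc _ ≤ M * growth α (A + t) β (B + t) (2 * q + k) (k + 1) +
            M * growth α (A + t) β (B + t) (2 * q + k + J) (k + 1) :=
            add_le_add (hM _ _ x hx) (hM _ _ x hx)
        _ ≤ _ := by rw [← mul_add]; gcongr; exact hC k q) hy
  refine this.trans ?_
  calc _ ≤ 2 * Real.pi * D * (M * (C * g)) := by gcongr; exact hD q
    _ = _ := by ring

end FrHankel

/-! ### Multiplication by a chirp -/

namespace FrHankel

open Set Filter Topology

/-- If `l = 0` or `γ > 0`, then `l ≤ σ N^γ` for all large `N`; the finitely many remaining `N` go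
into `C`. -/
theorem exists_shift_pow_le {b γ σ l : ℝ} (hb : 0 ≤ b) (hσ : 0 < σ) (hl : 0 ≤ l)
    (h : l = 0 ∨ 0 < γ) :
    ∃ C, 0 ≤ C ∧ ∀ N : ℕ, (b * (N : ℝ) ^ γ + l) ^ N ≤
      C * ((b + σ) ^ N * (N : ℝ) ^ ((N : ℝ) * γ)) := by
  have hN : ∀ N : ℕ, (b + σ) ^ N * (N : ℝ) ^ ((N : ℝ) * γ) = ((b + σ) * (N : ℝ) ^ γ) ^ N := by
    intro N
    rw [mul_pow, ← Real.rpow_natCast (_ ^ γ), ← Real.rpow_mul N.cast_nonneg, mul_comm γ]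
  simp only [hN]
  have hpos : ∀ N : ℕ, 0 < ((b + σ) * (N : ℝ) ^ γ) ^ N := by
    intro N
    rcases N.eq_zero_or_pos with rfl | h0
    · simp
    · have : (0 : ℝ) < N := by exact_mod_cast h0
      positivity
  have hev : ∀ᶠ N : ℕ in atTop,
      (b * (N : ℝ) ^ γ + l) ^ N / ((b + σ) * (N : ℝ) ^ γ) ^ N ≤ 1 := by
    have hle : ∀ᶠ N : ℕ in atTop, l ≤ σ * (N : ℝ) ^ γ := by
      rcases h with rfl | h
      · exact Eventually.of_forall fun N => by positivity
      · exact (((tendsto_rpow_atTop h).comp tendsto_natCast_atTop_atTop).const_mul_atTop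
          hσ).eventually_ge_atTop l
    filter_upwards [hle] with N h1
    rw [div_le_one (hpos N)]
    gcongr
    linarith
  obtain ⟨C, hC⟩ := (IsBoundedUnder.bddAbove_range
    (isBoundedUnder_of_eventually_le hev) : BddAbove (range _))
  have hC' : ∀ N : ℕ, (b * (N : ℝ) ^ γ + l) ^ N ≤ C * ((b + σ) * (N : ℝ) ^ γ) ^ N := fun N => by
    rw [← div_le_iff₀ (hpos N)]; exact hC ⟨N, rfl⟩
  refine ⟨C, ?_, hC'⟩
  have := hC' 0
  rw [pow_zero, pow_zero, mul_one] at this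
  linarith

/-- The operator `x⁻¹ D_x + l`. -/
noncomputable def xinvDAdd (l : ℂ) (F : ℝ → ℂ) : ℝ → ℂ := xinvD F + l • F

theorem xinvDAdd_contDiffOn (l : ℂ) {F : ℝ → ℂ} (hF : ContDiffOn ℝ ∞ F (Ioi 0)) :
    ContDiffOn ℝ ∞ (xinvDAdd l F) (Ioi 0) :=
  (xinvD_contDiffOn hF).add (hF.const_smul l)

theorem iterate_xinvDAdd_contDiffOn (l : ℂ) {F : ℝ → ℂ} (hF : ContDiffOn ℝ ∞ F (Ioi 0)) (q : ℕ) :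
    ContDiffOn ℝ ∞ ((xinvDAdd l)^[q] F) (Ioi 0) := by
  induction q with
  | zero => exact hF
  | succ q ih => rw [Function.iterate_succ_apply']; exact xinvDAdd_contDiffOn l ih

/-- The chirp `e^{l x²/2}`. -/
noncomputable def chirp (l : ℂ) (x : ℝ) : ℂ := Complex.exp (l / 2 * ((x ^ 2 : ℝ) : ℂ))

theorem chirp_hasDerivAt (l : ℂ) (x : ℝ) : HasDerivAt (chirp l) (l * x * chirp l x) x := by
  have h := (((hasDerivAt_pow 2 x).ofReal_comp).const_mul (l / 2)).cexp
  refine HasDerivAt.congr_deriv (f := chirp l) h ?_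
  rw [chirp]
  push_cast
  ring

theorem xinvD_chirp_mul (l : ℂ) {F : ℝ → ℂ} (hF : ContDiffOn ℝ ∞ F (Ioi 0)) :
    EqOn (xinvD (chirp l * F)) (chirp l * xinvDAdd l F) (Ioi 0) := by
  intro x hx
  have hx0 : (x : ℂ) ≠ 0 := by exact_mod_cast ne_of_gt (mem_Ioi.1 hx)
  rw [xinvD, ((chirp_hasDerivAt l x).mul (differentiableAt_of_contDiffOn hF hx).hasDerivAt).deriv]
  simp only [xinvDAdd, xinvD, Pi.mul_apply, Pi.add_apply, Pi.smul_apply, smul_eq_mul]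
  push_cast
  field_simp
  ring

theorem iterate_chirp_mul (l : ℂ) {F : ℝ → ℂ} (hF : ContDiffOn ℝ ∞ F (Ioi 0)) (q : ℕ) :
    EqOn (xinvD^[q] (chirp l * F)) (chirp l * (xinvDAdd l)^[q] F) (Ioi 0) := by
  induction q with
  | zero => exact fun x _ => rfl
  | succ q ih =>
    rw [Function.iterate_succ_apply', Function.iterate_succ_apply']
    exact (xinvD_congr ih).trans (xinvD_chirp_mul l (iterate_xinvDAdd_contDiffOn l hF q))

/-- Each application of `x⁻¹D_x + l` to a sequence dominated by `ρ^m` multiplies the bound by `ρ +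
‖l‖`. Only orders up to `N` are used, so `ρ` may depend on `N`. -/
theorem norm_iterate_xinvDAdd_le (l : ℂ) {F : ℝ → ℂ} (hF : ContDiffOn ℝ ∞ F (Ioi 0)) {y : ℝ}
    (hy : 0 < y) {w M ρ : ℝ} (hw : 0 ≤ w) {N : ℕ}
    (hM : ∀ m ≤ N, w * ‖xinvD^[m] F y‖ ≤ M * ρ ^ m) (q : ℕ) :
    ∀ m, m + q ≤ N →
      w * ‖xinvD^[m] ((xinvDAdd l)^[q] F) y‖ ≤ M * (ρ + ‖l‖) ^ q * ρ ^ m := by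
  induction q with
  | zero => intro m hm; simpa using hM m hm
  | succ q ih =>
    intro m hm
    set G := (xinvDAdd l)^[q] F with hG
    have hGs : ContDiffOn ℝ ∞ G (Ioi 0) := iterate_xinvDAdd_contDiffOn l hF q
    have h1 := ih (m + 1) (by omega)
    have h2 := ih m (by omega)
    rw [Function.iterate_succ_apply', ← hG, xinvDAdd,
      iterate_add (g := l • G) (xinvD_contDiffOn hGs) (hGs.const_smul l) m hy, Pi.add_apply,
      iterate_smul l hGs m hy, Pi.smul_apply, ← Function.iterate_succ_apply]
    calc _ ≤ w * (‖xinvD^[m + 1] G y‖ + ‖l‖ * ‖xinvD^[m] G y‖) := by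
          gcongr; exact (norm_add_le _ _).trans_eq (by rw [norm_smul])
      _ = w * ‖xinvD^[m + 1] G y‖ + ‖l‖ * (w * ‖xinvD^[m] G y‖) := by ring
      _ ≤ M * (ρ + ‖l‖) ^ q * ρ ^ (m + 1) + ‖l‖ * (M * (ρ + ‖l‖) ^ q * ρ ^ m) := by gcongr
      _ = _ := by ring

theorem exists_chirp_growth {α a b γ σ : ℝ} {l : ℂ} (hl : l.re = 0) (ha : 0 ≤ a) (hb : 0 ≤ b) (hγ : 0 ≤ γ)
    (hσ : 0 < σ) (h : l = 0 ∨ 0 < γ) :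
    ∃ C, 0 ≤ C ∧ ∀ (F : ℝ → ℂ) (M : ℝ), 0 ≤ M → ContDiffOn ℝ ∞ F (Ioi 0) →
      (∀ (k q : ℕ) (x : ℝ), 0 < x → x ^ k * ‖xinvD^[q] F x‖ ≤ M * growth α a γ b k q) →
      (∀ (k q : ℕ) (x : ℝ), 0 < x → x ^ k * ‖xinvD^[q] (chirp l * F) x‖ ≤
        C * M * growth α a γ (b + σ) k q) := by
  obtain ⟨C, hC0, hC⟩ := exists_shift_pow_le hb hσ (norm_nonneg l) (by simpa using h)
  refine ⟨C, hC0, fun F M hM hF hFM k q x hx => ?_⟩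
  have hch : ‖chirp l x‖ = 1 := by
    rw [chirp, Complex.norm_exp]
    have : (l / 2 * ((x ^ 2 : ℝ) : ℂ)).re = 0 := by
      rw [Complex.re_mul_ofReal]; simp [hl]
    rw [this, Real.exp_zero]
  rw [iterate_chirp_mul l hF q hx, Pi.mul_apply, norm_mul, hch, one_mul]
  -- For fixed `q`, the bound `m^{mγ} ≤ (q^γ)^m` for `m ≤ q` makes the derivatives geometrically
  -- dominated with ratio `b q^γ`.
  have key := norm_iterate_xinvDAdd_le l hF hx (w := x ^ k) (by positivity) (N := q)
    (M := M * (a ^ k * (k : ℝ) ^ ((k : ℝ) * α))) (ρ := b * (q : ℝ) ^ γ) (fun m hm => by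
      refine (hFM k m x hx).trans ?_
      have h1 : (m : ℝ) ^ ((m : ℝ) * γ) ≤ ((q : ℝ) ^ γ) ^ m := by
        rw [mul_comm, Real.rpow_mul m.cast_nonneg, Real.rpow_natCast]
        gcongr
      rw [growth, mul_pow, mul_assoc M]
      gcongr) q 0 (by omega)
  rw [pow_zero, mul_one] at key
  refine key.trans ?_
  calc _ ≤ M * (a ^ k * (k : ℝ) ^ ((k : ℝ) * α)) *
        (C * ((b + σ) ^ q * (q : ℝ) ^ ((q : ℝ) * γ))) := by gcongr; exact hC q
    _ = _ := by unfold growth; ring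

/-! ### Reduction of the fractional Hankel transform -/

/-- The constant in front of the transform written through `cliffordTransform`. -/
noncomputable def invHankelConst (ν μ θ : ℝ) : ℂ :=
  (starRingEnd ℂ) (hankelConst ν μ θ) *
    (((Real.sin θ)⁻¹ ^ (-μ) * ((Real.sin θ)⁻¹ / 2) ^ ν : ℝ) : ℂ)

/-- The chirp in `x² + y²` and the powers of `xy` separate. The function enters only through its
weight of sign `-1`, which is why that sign is needed in the source space. -/
theorem invKernel_mul_eq {ν μ θ : ℝ} (hθ : θ ∈ Ioo 0 Real.pi) (f : ℝ → ℂ) {x y : ℝ} (hx : 0 < x)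
    (hy : 0 < y) :
    invKernel ν μ θ x y * f x =
      invHankelConst ν μ θ * Complex.exp (-(Complex.I / 2) * ((y ^ 2 * Real.cot θ : ℝ) : ℂ)) *
        ((y ^ (ν - μ) : ℝ) : ℂ) *
        (cliffordKernel ν ((Real.sin θ)⁻¹ / 2) y x • weighted ν μ θ (-1) f x) := by
  have hs : 0 < (Real.sin θ)⁻¹ := inv_pos.2 (Real.sin_pos_of_mem_Ioo hθ)
  set c := (Real.sin θ)⁻¹ with hc
  have e1 : x * y * c / 2 = x * y * (c / 2) := by ring
  have e2 : (x * y * c) ^ (-μ) * (x * y * (c / 2)) ^ ν * x ^ (1 + 2 * μ) =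
      c ^ (-μ) * (c / 2) ^ ν * y ^ (ν - μ) * x ^ (2 * ν + 1) * x ^ (μ - ν) := by
    rw [Real.mul_rpow (by positivity) hs.le, Real.mul_rpow hx.le hy.le,
      Real.mul_rpow (by positivity) (by positivity), Real.mul_rpow hx.le hy.le]
    have h1 : y ^ (ν - μ) = y ^ (-μ) * y ^ ν := by rw [← Real.rpow_add hy]; ring_nf
    have h2 : x ^ (2 * ν + 1) * x ^ (μ - ν) = x ^ (-μ) * x ^ ν * x ^ (1 + 2 * μ) := by
      rw [← Real.rpow_add hx, ← Real.rpow_add hx, ← Real.rpow_add hx]; ring_nf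
    rw [h1, mul_assoc _ (x ^ (2 * ν + 1)), h2]
    ring
  have e3 : Complex.exp (-(Complex.I / 2) * (((x ^ 2 + y ^ 2) * Real.cot θ : ℝ) : ℂ)) =
      Complex.exp (-(Complex.I / 2) * ((y ^ 2 * Real.cot θ : ℝ) : ℂ)) *
        Complex.exp (((-1 : ℝ) : ℂ) * (Complex.I / 2) * ((x ^ 2 * Real.cot θ : ℝ) : ℂ)) := by
    rw [← Complex.exp_add]; congr 1; push_cast; ring
  have e4 : (x * y * c) ^ (-μ) * besselJ ν (x * y * c) * x ^ (1 + 2 * μ) =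
      c ^ (-μ) * (c / 2) ^ ν * y ^ (ν - μ) * x ^ (μ - ν) * cliffordKernel ν (c / 2) y x := by
    rw [besselJ_eq (by positivity), e1, cliffordKernel]
    linear_combination clifford ν ((x * y * (c / 2)) ^ 2) * e2
  rw [invKernel, kernel, ← hc, e4, map_mul, map_mul, ← Complex.exp_conj, map_mul,
    Complex.conj_ofReal, Complex.conj_ofReal, map_div₀, Complex.conj_I, Complex.conj_ofNat, neg_div,
    e3, weighted, invHankelConst, ← hc, Complex.real_smul]
  push_cast
  ring

theorem invHankel_eq {ν μ θ : ℝ} (hθ : θ ∈ Ioo 0 Real.pi) (f : ℝ → ℂ) {y : ℝ} (hy : 0 < y) :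
    invHankel ν μ θ f y =
      invHankelConst ν μ θ * Complex.exp (-(Complex.I / 2) * ((y ^ 2 * Real.cot θ : ℝ) : ℂ)) *
        ((y ^ (ν - μ) : ℝ) : ℂ) *
        cliffordTransform ν ((Real.sin θ)⁻¹ / 2) (weighted ν μ θ (-1) f) y := by
  rw [invHankel, cliffordTransform, ← MeasureTheory.integral_const_mul]
  exact MeasureTheory.setIntegral_congr_fun measurableSet_Ioi
    fun x hx => invKernel_mul_eq hθ f hx hy

/-- The inverse transform, extended by `0` to the real line. -/
noncomputable def invHankelExt (ν μ θ : ℝ) (f : ℝ → ℂ) (y : ℝ) : ℂ :=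
  if 0 < y then invHankel ν μ θ f y else 0

/-- The powers of `y` cancel and the chirps combine to `e^{i(ε-1)y² cot θ / 2}`, which is trivial
for `ε = 1`. -/
theorem weighted_invHankelExt {ν μ θ : ℝ} (hθ : θ ∈ Ioo 0 Real.pi) (ε : ℝ) (f : ℝ → ℂ) :
    EqOn (weighted ν μ θ ε (invHankelExt ν μ θ f))
      (chirp (Complex.I * (((ε - 1) * Real.cot θ : ℝ) : ℂ)) * invHankelConst ν μ θ •
        cliffordTransform ν ((Real.sin θ)⁻¹ / 2) (weighted ν μ θ (-1) f)) (Ioi 0) := by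
  intro y hy
  have hy0 : 0 < y := hy
  have e1 : chirp (Complex.I * (((ε - 1) * Real.cot θ : ℝ) : ℂ)) y =
      Complex.exp ((ε : ℂ) * (Complex.I / 2) * ((y ^ 2 * Real.cot θ : ℝ) : ℂ)) *
        Complex.exp (-(Complex.I / 2) * ((y ^ 2 * Real.cot θ : ℝ) : ℂ)) := by
    rw [chirp, ← Complex.exp_add]; congr 1; push_cast; ring
  have e2 : ((y ^ (μ - ν) : ℝ) : ℂ) * ((y ^ (ν - μ) : ℝ) : ℂ) = 1 := by
    rw [← Complex.ofReal_mul, ← Real.rpow_add hy0]; simp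
  rw [weighted, invHankelExt, if_pos hy0, invHankel_eq hθ f hy0, Pi.mul_apply, Pi.smul_apply,
    smul_eq_mul, e1]
  linear_combination (Complex.exp ((ε : ℂ) * (Complex.I / 2) * ((y ^ 2 * Real.cot θ : ℝ) : ℂ)) *
    Complex.exp (-(Complex.I / 2) * ((y ^ 2 * Real.cot θ : ℝ) : ℂ)) * invHankelConst ν μ θ *
    cliffordTransform ν ((Real.sin θ)⁻¹ / 2) (weighted ν μ θ (-1) f) y) * e2

theorem invHankelExt_contDiffOn {ν μ θ : ℝ} (hν : -(1 / 2) ≤ ν) (hθ : θ ∈ Ioo 0 Real.pi)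
    {f : ℝ → ℂ} (hf : RapidSmooth (weighted ν μ θ (-1) f)) :
    ContDiffOn ℝ ∞ (invHankelExt ν μ θ f) (Ioi 0) := by
  have h : ContDiffOn ℝ ∞ (fun y : ℝ => invHankelConst ν μ θ *
      Complex.exp (-(Complex.I / 2) * ((y ^ 2 * Real.cot θ : ℝ) : ℂ)) *
        ((y ^ (ν - μ) : ℝ) : ℂ) *
        cliffordTransform ν ((Real.sin θ)⁻¹ / 2) (weighted ν μ θ (-1) f) y) (Ioi 0) := by
    refine ContDiffOn.mul (ContDiffOn.mul (contDiffOn_const.mul ?_) ?_)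
      (cliffordTransform_contDiff hν _ hf).contDiffOn
    · apply ContDiff.contDiffOn
      apply ContDiff.cexp
      apply ContDiff.mul contDiff_const
      exact Complex.ofRealCLM.contDiff.comp ((contDiff_id.pow 2).mul contDiff_const)
    · apply Complex.ofRealCLM.contDiff.comp_contDiffOn
      exact contDiffOn_id.rpow_const_of_ne fun x hx => ne_of_gt hx
  refine h.congr fun y hy => ?_
  rw [invHankelExt, if_pos (mem_Ioi.1 hy), invHankel_eq hθ f hy]

theorem invKernel_integrableOn {ν μ θ : ℝ} (hν : -(1 / 2) ≤ ν) (hθ : θ ∈ Ioo 0 Real.pi)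
    {f : ℝ → ℂ} (hf : RapidSmooth (weighted ν μ θ (-1) f)) {y : ℝ} (hy : 0 < y) :
    MeasureTheory.IntegrableOn (fun x => invKernel ν μ θ x y * f x) (Ioi 0) :=
  (MeasureTheory.integrableOn_congr_fun (fun _ hx => invKernel_mul_eq hθ f hx hy)
    measurableSet_Ioi).2
    ((cliffordKernel_integrableOn hν _ y hf.1.continuousOn (hf.2 0)).const_mul _)

/-- The bound of the quotients of the transform by the growth of the function. -/
theorem exists_quotient_invHankelExt_le {ν μ θ : ℝ} (hν : -(1 / 2) ≤ ν) (hθ : θ ∈ Ioo 0 Real.pi)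
    {α β A B : ℝ} (hα : 0 ≤ α) (hβ : 0 ≤ β) (hA : 0 ≤ A) (hB : 0 ≤ B) {ε : ℝ}
    (hε : ε = 1 ∨ 0 < α) {δ σ : ℝ} (hδ : 0 < δ) (hσ : 0 < σ) :
    ∃ t, 0 < t ∧ ∃ C, 0 ≤ C ∧ ∀ (f : ℝ → ℂ) (M : ℝ), ContDiffOn ℝ ∞ f (Ioi 0) →
      (∀ (k q : ℕ) (x : ℝ), 0 < x → x ^ k * ‖xinvD^[q] (weighted ν μ θ (-1) f) x‖ ≤
        M * growth α (A + t) β (B + t) k q) →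
      ∀ i, quotient ν μ θ ε (α + β) (A * B * Real.exp α + δ) (2 * α)
        (A ^ 2 * (2 * Real.exp 1) ^ (2 * α) + σ) (invHankelExt ν μ θ f) i ≤ C * M := by
  have hs : 0 < Real.sin θ := Real.sin_pos_of_mem_Ioo hθ
  have hr : 1 / 2 ≤ (Real.sin θ)⁻¹ / 2 := by
    have := (one_le_inv₀ hs).2 (Real.sin_le_one θ)
    linarith
  set l : ℂ := Complex.I * (((ε - 1) * Real.cot θ : ℝ) : ℂ) with hl
  have hre : l.re = 0 := by rw [hl, Complex.re_mul_ofReal, Complex.I_re, zero_mul]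
  have hl0 : l = 0 ∨ 0 < 2 * α := by
    rcases hε with rfl | h
    · left; simp [hl]
    · right; linarith
  -- One half of `σ` is spent on the transform, the other on the chirp.
  have hσ2 : 0 < σ / 2 := by positivity
  obtain ⟨t, ht, C₁, h₁, hC₁⟩ := exists_cliffordTransform_growth hν hr hα hβ hA hB hδ hσ2
  obtain ⟨C₂, h₂, hC₂⟩ := exists_chirp_growth (α := α + β) (a := A * B * Real.exp α + δ)
    (b := A ^ 2 * (2 * Real.exp 1) ^ (2 * α) + σ / 2) hre (by positivity) (by positivity)
    (by positivity) hσ2 hl0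
  refine ⟨t, ht, C₂ * (‖invHankelConst ν μ θ‖ * C₁), by positivity, fun f M hf hM => ?_⟩
  have hw := weighted_contDiffOn ν μ θ (-1) hf
  have hM0 : 0 ≤ M := by
    have h1 := hM 0 0 1 one_pos
    have h2 : growth α (A + t) β (B + t) 0 0 = 1 := by simp [growth]
    rw [h2, mul_one] at h1
    exact le_trans (by positivity) h1
  have hG : ContDiffOn ℝ ∞ (cliffordTransform ν ((Real.sin θ)⁻¹ / 2) (weighted ν μ θ (-1) f))
      (Ioi 0) := (cliffordTransform_contDiff hν _ (rapidSmooth_of_growth hw hM)).contDiffOn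
  have h3 := hC₁ _ M hw hM
  have h4 := hC₂ (invHankelConst ν μ θ •
    cliffordTransform ν ((Real.sin θ)⁻¹ / 2) (weighted ν μ θ (-1) f))
    (‖invHankelConst ν μ θ‖ * (C₁ * M)) (by positivity) (hG.const_smul (invHankelConst ν μ θ))
    (fun k q x hx => by
      rw [iterate_smul _ hG q hx, Pi.smul_apply, norm_smul, mul_left_comm, mul_assoc]
      exact mul_le_mul_of_nonneg_left (h3 k q x hx) (norm_nonneg _))
  rintro ⟨k, q, x, hx⟩
  have hx0 : 0 < x := hx
  rw [quotient, div_le_iff₀ (growth_pos _ _ (by positivity) (by positivity) _ _), norm_mul,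
    Complex.norm_real, Real.norm_of_nonneg (by positivity),
    iterate_congr (weighted_invHankelExt hθ ε f) q hx]
  refine (h4 k q x hx).trans_eq ?_
  have e : A ^ 2 * (2 * Real.exp 1) ^ (2 * α) + σ / 2 + σ / 2 =
    A ^ 2 * (2 * Real.exp 1) ^ (2 * α) + σ := by ring
  rw [e]
  ring

/-! ### Continuity between the spaces of type S -/

namespace TypeS

variable {ν μ θ : ℝ} {S : Set ℝ} {α : ℝ} {A : NNReal} {β : ℝ} {B : NNReal}

theorem withSeminorms : WithSeminorms
    (norm (ν := ν) (μ := μ) (θ := θ) (S := S) (α := α) (A := A) (β := β) (B := B)) := by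
  have : IsTopologicalAddGroup (TypeS ν μ θ S α A β B) :=
    topologicalAddGroup_iInf fun i =>
      (norm (ν := ν) (μ := μ) (θ := θ) (α := α) (A := A) (β := β) (B := B)
        i).toSeminormedAddCommGroup.toIsTopologicalAddGroup
  exact (SeminormFamily.withSeminorms_iff_topologicalSpace_eq_iInf _).2 rfl

theorem pow_mul_norm_le (f : TypeS ν μ θ S α A β B) (i : S × Ioi (0 : ℝ) × Ioi (0 : ℝ)) (k q : ℕ)
    {x : ℝ} (hx : 0 < x) :
    x ^ k * ‖xinvD^[q] (weighted ν μ θ i.1 f) x‖ ≤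
      norm i f * growth α (A + i.2.1) β (B + i.2.2) k q := by
  have hδ : (0 : ℝ) < i.2.1 := i.2.1.2
  have hσ : (0 : ℝ) < i.2.2 := i.2.2.2
  have h := le_ciSup (f.2.2.2 i.1 i.1.2 _ hδ _ hσ) (k, q, ⟨x, hx⟩)
  rw [← div_le_iff₀ (growth_pos _ _ (by positivity) (by positivity) _ _)]
  refine le_trans (le_of_eq ?_) h
  rw [quotient, norm_mul, Complex.norm_real, Real.norm_of_nonneg (by positivity)]

theorem rapidSmooth (hS : -1 ∈ S) (f : TypeS ν μ θ S α A β B) :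
    RapidSmooth (weighted ν μ θ (-1) f) :=
  rapidSmooth_of_growth (weighted_contDiffOn ν μ θ (-1) f.2.2.1) fun k q _ hx =>
    pow_mul_norm_le f ⟨⟨-1, hS⟩, ⟨1, mem_Ioi.2 one_pos⟩, ⟨1, mem_Ioi.2 one_pos⟩⟩ k q hx

theorem exists_quotient_le (hν : -(1 / 2) ≤ ν) (hθ : θ ∈ Ioo 0 Real.pi) (hα : 0 ≤ α) (hβ : 0 ≤ β)
    (hS : -1 ∈ S) {ε : ℝ} (hε : ε = 1 ∨ 0 < α) {δ σ : ℝ} (hδ : 0 < δ) (hσ : 0 < σ) :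
    ∃ i : S × Ioi (0 : ℝ) × Ioi (0 : ℝ), ∃ C, 0 ≤ C ∧ ∀ (f : TypeS ν μ θ S α A β B) j,
      quotient ν μ θ ε (α + β) ((A * B * Real.exp α).toNNReal + δ) (2 * α)
        ((A ^ 2 * (2 * Real.exp 1) ^ (2 * α)).toNNReal + σ) (invHankelExt ν μ θ f) j ≤
      C * norm i f := by
  obtain ⟨t, ht, C, hC0, hC⟩ := exists_quotient_invHankelExt_le (μ := μ) hν hθ hα hβ A.2 B.2 hε
    hδ hσ
  refine ⟨⟨⟨-1, hS⟩, ⟨t, ht⟩, ⟨t, ht⟩⟩, C, hC0, fun f j => ?_⟩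
  rw [Real.coe_toNNReal _ (by positivity), Real.coe_toNNReal _ (by positivity)]
  exact hC f _ f.2.2.1
    (fun k q x hx => pow_mul_norm_le f ⟨⟨-1, hS⟩, ⟨t, ht⟩, ⟨t, ht⟩⟩ k q hx) j

/-- The inverse transform as a continuous linear map between spaces of type S. -/
theorem exists_invHankel_continuousLinearMap (hν : -(1 / 2) ≤ ν) (hθ : θ ∈ Ioo 0 Real.pi)
    (hα : 0 ≤ α) (hβ : 0 ≤ β) (hS : -1 ∈ S) {S' : Set ℝ} (hS' : ∀ ε ∈ S', ε = 1 ∨ 0 < α) :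
    ∃ T : TypeS ν μ θ S α A β B →L[ℂ]
        TypeS ν μ θ S' (α + β) (A * B * Real.exp α).toNNReal
          (2 * α) (A ^ 2 * (2 * Real.exp 1) ^ (2 * α)).toNNReal,
      ∀ f : TypeS ν μ θ S α A β B, ∀ y : ℝ, 0 < y →
        MeasureTheory.IntegrableOn (fun x => invKernel ν μ θ x y * f x) (Ioi 0) ∧
          T f y = invHankel ν μ θ f y := by
  have hint : ∀ (f : TypeS ν μ θ S α A β B) (y : ℝ), 0 < y →
      MeasureTheory.IntegrableOn (fun x => invKernel ν μ θ x y * f x) (Ioi 0) :=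
    fun f y hy => invKernel_integrableOn hν hθ (rapidSmooth hS f) hy
  let T₀ : TypeS ν μ θ S α A β B →ₗ[ℂ]
      TypeS ν μ θ S' (α + β) (A * B * Real.exp α).toNNReal
        (2 * α) (A ^ 2 * (2 * Real.exp 1) ^ (2 * α)).toNNReal :=
    { toFun := fun f => ⟨invHankelExt ν μ θ f, fun y hy => if_neg (not_lt.2 hy),
        invHankelExt_contDiffOn hν hθ (rapidSmooth hS f), fun ε hε δ hδ σ hσ => by
          obtain ⟨i, C, -, hC⟩ := exists_quotient_le (A := A) (B := B) (μ := μ) hν hθ hα hβ hS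
            (hS' ε hε) hδ hσ
          refine ⟨C * norm i f, ?_⟩
          rintro _ ⟨j, rfl⟩
          exact hC f j⟩
      map_add' := fun f g => by
        refine Subtype.ext (funext fun y => ?_)
        change invHankelExt ν μ θ (f.1 + g.1) y =
          invHankelExt ν μ θ f.1 y + invHankelExt ν μ θ g.1 y
        by_cases hy : 0 < y
        · simp only [invHankelExt, if_pos hy, invHankel, Pi.add_apply, mul_add]
          exact MeasureTheory.integral_add (hint f y hy) (hint g y hy)
        · simp only [invHankelExt, if_neg hy, add_zero]
      map_smul' := fun c f => by
        refine Subtype.ext (funext fun y => ?_)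
        change invHankelExt ν μ θ (c • f.1) y = c * invHankelExt ν μ θ f.1 y
        by_cases hy : 0 < y
        · simp only [invHankelExt, if_pos hy, invHankel, Pi.smul_apply, smul_eq_mul,
            mul_left_comm _ c]
          exact MeasureTheory.integral_const_mul _ _
        · simp only [invHankelExt, if_neg hy, mul_zero] }
  -- Continuity reduces to bounding each target norm by a multiple of a single source norm, taken
  -- with sign `-1` and `δ = σ = t`.
  refine ⟨⟨T₀, withSeminorms.continuous_of_isBounded withSeminorms T₀
    (Seminorm.IsBounded.of_real fun i => ?_)⟩, fun f y hy => ⟨hint f y hy, if_pos hy⟩⟩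
  obtain ⟨j, C, -, hC⟩ := exists_quotient_le (A := A) (B := B) (μ := μ) hν hθ hα hβ hS
    (hS' i.1 i.1.2) i.2.1.2 i.2.2.2
  refine ⟨{j}, C, fun f => ?_⟩
  rw [Finset.sup_singleton]
  have : Nonempty (ℕ × ℕ × Ioi (0 : ℝ)) := ⟨(0, 0, ⟨1, mem_Ioi.2 one_pos⟩)⟩
  exact ciSup_le fun n => hC f n

end TypeS

end FrHankel

theorem theorem2p6 (ν μ θ : ℝ) (hν : -(1 / 2) ≤ ν) (hθ : θ ∈ Set.Ioo 0 Real.pi)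
    (α β : ℝ) (hα : 0 ≤ α) (hβ : 0 ≤ β) (A B : NNReal) :
    (∃ T : FrHankel.TypeS ν μ θ {-1} α A β B →L[ℂ]
        FrHankel.TypeS ν μ θ {1} (α + β) (A * B * Real.exp α).toNNReal
          (2 * α) (A ^ 2 * (2 * Real.exp 1) ^ (2 * α)).toNNReal,
      ∀ f : FrHankel.TypeS ν μ θ {-1} α A β B, ∀ y : ℝ, 0 < y →
        MeasureTheory.IntegrableOn (fun x => FrHankel.invKernel ν μ θ x y * f x) (Set.Ioi 0) ∧
          T f y = FrHankel.invHankel ν μ θ f y) ∧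
    (0 < α →
      ∃ T : FrHankel.TypeS ν μ θ {1, -1} α A β B →L[ℂ]
          FrHankel.TypeS ν μ θ {1, -1} (α + β) (A * B * Real.exp α).toNNReal
            (2 * α) (A ^ 2 * (2 * Real.exp 1) ^ (2 * α)).toNNReal,
        ∀ f : FrHankel.TypeS ν μ θ {1, -1} α A β B, ∀ y : ℝ, 0 < y →
          MeasureTheory.IntegrableOn (fun x => FrHankel.invKernel ν μ θ x y * f x) (Set.Ioi 0) ∧
            T f y = FrHankel.invHankel ν μ θ f y) :=
  ⟨FrHankel.TypeS.exists_invHankel_continuousLinearMap hν hθ hα hβ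
      (Set.mem_singleton _) fun _ hε => Or.inl hε,
    fun h => FrHankel.TypeS.exists_invHankel_continuousLinearMap hν hθ hα hβ
      (Set.mem_insert_of_mem _ (Set.mem_singleton _)) fun _ _ => Or.inr h⟩
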